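/- A congestion game has a finite player set $\mathcal N=[n]$, a finite resource set $R$, an action set $\mathcal A_i\subseteq 2^R$ for each player $i$, and a delay function $d_r:\mathbb N\to\mathbb R_{\ge 0}$ for each $r\in R$. In an outcome $A\in\prod_i\mathcal A_i$ player $i$ pays $c_i(A)=\sum_{r\in A_i}d_r(x(A)_r)$, where $x(A)_r=|\{j: r\in A_j\}|$; the social cost is $SC(A)=\sum_i c_i(A)$, and $A$ is a Nash equilibrium if no player can lower his cost by changing only his own action. A $1$-lookahead outcome is an outcome $A$ for which there is an order on the players such that each player's action is a subgame-perfect choice in the one-player game that he faces after the actions in $A$ of the players before him (i.e. he minimizes his current cost $\sum_{r\in P}d_r(1+|\{j \text{ before } i: r\in A_j\}|)$ over $P\in\mathcal A_i$). The $1$-Lookahead Price of Anarchy $1\text{-}\mathsf{LPoA}(G)$ is the maximum of $SC(A)/\min_B SC(B)$ over the $1$-lookahead outcomes $A$, and the Price of Stability $\mathsf{PoS}(G)$ is the minimum of this ratio over the Nash equilibria $A$ (with $0/0=1$). A series-parallel graph is a directed multigraph with origin $o$ and destination $t$ that is either a single arc or a composition of two series-parallel graphs in series or in parallel. A symmetric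 network congestion game on it has the arcs as resources, and the action set of each player consists of all directed $o$-$t$ paths. Let $\mathcal D$ be a class of non-decreasing functions $d:\mathbb N\to\mathbb R_{\ge0}$ and let $$\rho(\mathcal D)=\Bigl(1-\sup_{d\in\mathcal D\setminus\{0\}}\ \sup_{x,y\in\mathbb N}\frac{y\,(d(x)-d(y))}{x\,d(x)}\Bigr)^{-1}\in[1,\infty]$$ (terms with $x\,d(x)=0$ are read as $0$, and the supremum of the empty set as $0$). Then: 1. For every symmetric network congestion game $G$ on a series-parallel graph with delay functions in $\mathcal D$ we have $1\text{-}\mathsf{LPoA}(G)\le\rho(\mathcal D)$. 2. If $d(1)>0$ for at least one $d\in\mathcal D$, then $\rho(\mathcal D)$ is equal to the Price of Stability of this class of games, i.e. to the supremum of $\mathsf{PoS}(G)$ over all symmetric network congestion games $G$ on series-parallel graphs with delay functions in $\mathcal D$. 3. If $\mathcal D$ consists of all affine functions $x\mapsto ax+b$ with $a,b\ge0$, then $\rho(\mathcal D)=4/3$. -/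

import Mathlib

open scoped NNReal ENNReal

noncomputable section

/-- A congestion game with player set `N` and resource set `R`: every player has a set of actions,
each action being a set of resources, and every resource has a delay function. -/
structure CongestionGame (N R : Type*) where
  actions : N → Set (Finset R)
  delay : R → ℕ → ℝ≥0

namespace CongestionGame

variable {N R : Type*}

/-- Action profiles (outcomes). -/
abbrev Profile (G : CongestionGame N R) : Type _ := ∀ i : N, G.actions i

/-- The number of players that use resource `r` in the profile `A`. -/
def congestion (G : CongestionGame N R) (A : G.Profile) (r : R) : ℕ :=
  {i : N | r ∈ (A i : Finset R)}.ncard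

/-- The cost of player `i`. -/
def cost (G : CongestionGame N R) (A : G.Profile) (i : N) : ℝ≥0 :=
  ∑ r ∈ (A i : Finset R), G.delay r (G.congestion A r)

/-- Pure Nash equilibria. -/
def IsNash (G : CongestionGame N R) (A : G.Profile) : Prop :=
  ∀ (i : N) (B : G.Profile), (∀ j, j ≠ i → B j = A j) → G.cost A i ≤ G.cost B i

/-- The game in which only the players with property `p` play. -/
def restrict (G : CongestionGame N R) (p : N → Prop) : CongestionGame {i : N // p i} R where
  actions i := G.actions i
  delay := G.delay

/-- The subgame induced by the actions, in `A`, of the players with property `p`: the other players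
remain, and the delay of a resource takes the players that are already there into account. -/
def induced (G : CongestionGame N R) (p : N → Prop) (A : G.Profile) :
    CongestionGame {i : N // ¬ p i} R where
  actions i := G.actions i
  delay r y := G.delay r (y + {j : N | p j ∧ r ∈ (A j : Finset R)}.ncard)

/-! ### Sequential play

The order in which the players move is given by an injective ranking `σ : N → ℕ`; only the
relative order of the ranks matters. -/

/-- The game in which only the first `k` players of the order play (all of them if there are at most
`k`). -/
def firstPlayers (G : CongestionGame N R) (σ : N → ℕ) (k : ℕ) :
    CongestionGame {i : N // {j : N | σ j < σ i}.ncard < k} R :=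
  G.restrict fun i => {j : N | σ j < σ i}.ncard < k

/-- Strategy profiles of the sequential-move version: every player chooses an action as a function
of the actions of the players before him. -/
abbrev StrategyProfile (G : CongestionGame N R) (σ : N → ℕ) : Type _ :=
  ∀ i : N, (∀ j : {j : N // σ j < σ i}, G.actions j) → G.actions i

/-- In the profile `A`, all players of rank at least `t` play as `S` tells them. -/
def Follows (G : CongestionGame N R) (σ : N → ℕ) (S : G.StrategyProfile σ) (t : ℕ)
    (A : G.Profile) : Prop :=
  ∀ i, t ≤ σ i → A i = S i fun j => A j

/-- Subgame-perfect equilibria of the sequential-move version: in each subgame, that is, after the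
players of rank less than `t` have played their actions in `A`, no remaining player `i` can lower
his cost by changing only his own strategy. -/
def IsSubgamePerfect (G : CongestionGame N R) (σ : N → ℕ) (S : G.StrategyProfile σ) : Prop :=
  ∀ (t : ℕ) (A : G.Profile), G.Follows σ S t A →
    ∀ i, t ≤ σ i → ∀ T : G.StrategyProfile σ, (∀ j, j ≠ i → T j = S j) →
      ∀ B : G.Profile, (∀ j, σ j < t → B j = A j) → G.Follows σ T t B →
        G.cost A i ≤ G.cost B i

/-- Subgame-perfect outcomes with respect to the order `σ`. -/
def IsSubgamePerfectOutcome (G : CongestionGame N R) (σ : N → ℕ) (A : G.Profile) : Prop :=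
  ∃ S : G.StrategyProfile σ, G.IsSubgamePerfect σ S ∧ G.Follows σ S 0 A

/-- `k`-lookahead outcomes (`k ≥ 1`): for some order on the players, the action of each player `i`
is the one he plays in some subgame-perfect outcome of the game of the next `k` players (starting
with `i`) in the subgame induced by the actions of the players before `i`. -/
def IsLookaheadOutcome [Fintype N] (G : CongestionGame N R) (k : ℕ) (A : G.Profile) : Prop :=
  ∃ σ : N ≃ Fin (Fintype.card N), ∀ i : N,
    ∃ B : ((G.induced (fun j => σ j < σ i) A).firstPlayers (fun j => (σ j : ℕ)) k).Profile,
      ((G.induced (fun j => σ j < σ i) A).firstPlayers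
          (fun j => (σ j : ℕ)) k).IsSubgamePerfectOutcome (fun j => (σ j : ℕ)) B ∧
        ∃ h, (B ⟨⟨i, lt_irrefl (σ i)⟩, h⟩ : Finset R) = A i

/-! ### Inefficiency -/

/-- Utilitarian social cost. -/
def socialCost [Fintype N] (G : CongestionGame N R) (A : G.Profile) : ℝ≥0 :=
  ∑ i, G.cost A i

/-- The minimum social cost of an outcome. -/
def optimalCost [Fintype N] (G : CongestionGame N R) : ℝ≥0∞ :=
  ⨅ B : G.Profile, (G.socialCost B : ℝ≥0∞)

open scoped Classical in
/-- The ratio of the social cost of `A` to the minimum social cost. An outcome of cost `0` is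
optimal and has ratio `1`; if only the optimum has cost `0` the ratio is `∞`. -/
def inefficiency [Fintype N] (G : CongestionGame N R) (A : G.Profile) : ℝ≥0∞ :=
  if G.socialCost A = 0 then 1 else (G.socialCost A : ℝ≥0∞) / G.optimalCost

/-- The `k`-Lookahead Price of Anarchy of a game. -/
def lookaheadPoA [Fintype N] (G : CongestionGame N R) (k : ℕ) : ℝ≥0∞ :=
  ⨆ A : {A : G.Profile // G.IsLookaheadOutcome k A}, G.inefficiency A

/-- The Price of Stability of a game. -/
def priceOfStability [Fintype N] (G : CongestionGame N R) : ℝ≥0∞ :=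
  ⨅ A : {A : G.Profile // G.IsNash A}, G.inefficiency A

end CongestionGame

/-- A directed multigraph with arcs `E` and two special vertices, origin and destination. -/
structure Network (V E : Type*) where
  src : E → V
  tgt : E → V
  origin : V
  dest : V

namespace Network

variable {V E : Type*}

/-- The list of arcs `p` is a directed walk from `u` to `v`. -/
def IsWalk (Γ : Network V E) : V → List E → V → Prop
  | u, [], v => u = v
  | u, e :: p, v => Γ.src e = u ∧ Γ.IsWalk (Γ.tgt e) p v

/-- The list of arcs `p` is a directed path from origin to destination: a walk that visits no vertex
twice. -/
def IsPath (Γ : Network V E) (p : List E) : Prop :=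
  Γ.IsWalk Γ.origin p Γ.dest ∧ (Γ.origin :: p.map Γ.tgt).Nodup

/-- The arc sets of the directed paths from origin to destination. -/
def pathSets (Γ : Network V E) : Set (Finset E) :=
  {a | ∃ p : List E, Γ.IsPath p ∧ ∀ e, e ∈ a ↔ e ∈ p}

/-- The endpoints of a set of arcs. -/
def endpoints (Γ : Network V E) (F : Set E) : Set V :=
  Γ.src '' F ∪ Γ.tgt '' F

/-- The arcs `F` form a series-parallel graph with origin `s` and destination `t`: a single arc, or
two series-parallel graphs in series (sharing only the destination of the first, which is the origin
of the second) or in parallel (sharing only the common origin and the common destination). -/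
inductive SeriesParallelOn (Γ : Network V E) : V → V → Set E → Prop
  | arc (e : E) : Γ.src e ≠ Γ.tgt e → SeriesParallelOn Γ (Γ.src e) (Γ.tgt e) {e}
  | series (s m t : V) (F₁ F₂ : Set E) :
      SeriesParallelOn Γ s m F₁ → SeriesParallelOn Γ m t F₂ → Disjoint F₁ F₂ →
      Γ.endpoints F₁ ∩ Γ.endpoints F₂ = {m} → SeriesParallelOn Γ s t (F₁ ∪ F₂)
  | parallel (s t : V) (F₁ F₂ : Set E) :
      SeriesParallelOn Γ s t F₁ → SeriesParallelOn Γ s t F₂ → Disjoint F₁ F₂ →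
      Γ.endpoints F₁ ∩ Γ.endpoints F₂ = {s, t} → SeriesParallelOn Γ s t (F₁ ∪ F₂)

/-- The network is series-parallel. (Vertices without arcs are irrelevant; all arcs of such a
network lie on a path from origin to destination.) -/
def IsSeriesParallel (Γ : Network V E) : Prop :=
  Γ.SeriesParallelOn Γ.origin Γ.dest Set.univ

/-- The symmetric network congestion game with `n` players and delay functions `d`. -/
def game (Γ : Network V E) (n : ℕ) (d : E → ℕ → ℝ≥0) : CongestionGame (Fin n) E where
  actions _ := Γ.pathSets
  delay := d

end Network

/-- `ρ(D) = (1 - sup_{d ∈ D \ {0}} sup_{x, y ≥ 0} y (d x - d y) / (x d x))⁻¹`, which is `∞` if the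
supremum is `1`. The supremum is over non-negative numbers: negative terms do not matter, since
`y = x` gives the term `0`, and terms with `x * d x = 0` are read as `0`. -/
def rho (D : Set (ℕ → ℝ≥0)) : ℝ≥0∞ :=
  (1 - ⨆ d ∈ D \ {0}, ⨆ x : ℕ, ⨆ y : ℕ,
    ENNReal.ofReal ((y : ℝ) * ((d x : ℝ) - (d y : ℝ)) / ((x : ℝ) * (d x : ℝ))))⁻¹

/-- The Price of Stability of the symmetric network congestion games on series-parallel graphs with
delay functions in `D`: the worst case over all these games. -/
def classPriceOfStability (D : Set (ℕ → ℝ≥0)) : ℝ≥0∞ :=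
  sSup {q | ∃ (V E : Type) (Γ : Network V E) (n : ℕ) (d : E → ℕ → ℝ≥0),
    Finite V ∧ Finite E ∧ Γ.IsSeriesParallel ∧ (∀ e, d e ∈ D) ∧ q = (Γ.game n d).priceOfStability}

/-- Affine delay functions `x ↦ a x + b` with `a, b ≥ 0`. -/
def affineDelays : Set (ℕ → ℝ≥0) :=
  {d | ∃ a b : ℝ≥0, ∀ x : ℕ, d x = a * (x : ℝ≥0) + b}

end

/-! Upper bound. The network is replaced by its decomposition tree, on which the loads of a profile
form a flow. When each player in turn takes a cheapest path, the flow stays balanced: in every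
parallel composition no used path of one part costs more than entering the other
(`SPTree.balanced_add_path`). Balance is the local optimality condition for Rosenthal's potential,
and on series-parallel graphs it is global: moving from the loads `x` of a balanced flow to the
loads `y` of any flow of the same value, the sum over the arcs of the linearized potential changes
`marginal` is nonnegative (`SPTree.le_sum_marginal`, whose parallel step is
`SPTree.marginal_add_le`).

This one inequality is used twice. With β the supremum in `rho`, `cost_add_marginal_le` gives `x
d(x) + marginal ≤ y d(y) + β x d(x)` on each arc; summation yields `(1 - β) SC(A) ≤ SC(B)` for
greedy `A` and every `B`. If `B` is a unilateral deviation, the sum of the marginals is exactly the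
change of the deviator's cost, so greedy outcomes are Nash equilibria. As `1`-lookahead outcomes are
greedy and greedy outcomes exist, `rho` bounds both the lookahead Price of Anarchy and the Price of
Stability.

Lower bound. A discrete Pigou network puts a chain of `l` arcs with delay δ in parallel with `x`
chains of `k` arcs with delay δ₀, where `k` is least with `l δ(x) < k δ₀(1)`. In equilibrium all `x`
players use the first chain; keeping only `y` of them there costs at most `y l δ(y) + (x - y) k
δ₀(1)`. As `l` grows, `k δ₀(1) / l` tends to `δ(x)`, and the ratio to `1 / (1 - y (δ(x) - δ(y)) / (x
δ(x)))`.

For affine delays the supremum is `1/4`, by `4y(x - y) ≤ x²`. -/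

noncomputable section

/-! ### Decomposition trees: flows, balance and the potential. -/

/-- Series-parallel decomposition trees with arcs in `E`. -/
inductive SPTree (E : Type*)
  | arc (e : E) : SPTree E
  | series (T₁ T₂ : SPTree E) : SPTree E
  | parallel (T₁ T₂ : SPTree E) : SPTree E

namespace SPTree

variable {E : Type*}

/-- The value of the flow `x`. -/
def value : SPTree E → (E → ℕ) → ℕ
  | arc e, x => x e
  | series T₁ _, x => T₁.value x
  | parallel T₁ T₂, x => T₁.value x + T₂.value x

/-- Flow conservation. -/
def IsFlow : SPTree E → (E → ℕ) → Prop
  | arc _, _ => True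
  | series T₁ T₂, x => T₁.IsFlow x ∧ T₂.IsFlow x ∧ T₁.value x = T₂.value x
  | parallel T₁ T₂, x => T₁.IsFlow x ∧ T₂.IsFlow x

/-- The least cost of a path for an additional player. -/
def entryCost (d : E → ℕ → ℝ) : SPTree E → (E → ℕ) → ℝ
  | arc e, x => d e (x e + 1)
  | series T₁ T₂, x => T₁.entryCost d x + T₂.entryCost d x
  | parallel T₁ T₂, x => min (T₁.entryCost d x) (T₂.entryCost d x)

/-- The largest cost of a path in the support of the flow `x` (a junk value if the flow is `0`). -/
def maxCost (d : E → ℕ → ℝ) : SPTree E → (E → ℕ) → ℝ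
  | arc e, x => d e (x e)
  | series T₁ T₂, x => T₁.maxCost d x + T₂.maxCost d x
  | parallel T₁ T₂, x =>
      if T₁.value x = 0 then T₂.maxCost d x
      else if T₂.value x = 0 then T₁.maxCost d x
      else max (T₁.maxCost d x) (T₂.maxCost d x)

/-- In every parallel composition, no used path of one part is more costly than entering the
other part. -/
def Balanced (d : E → ℕ → ℝ) : SPTree E → (E → ℕ) → Prop
  | arc _, _ => True
  | series T₁ T₂, x => T₁.Balanced d x ∧ T₂.Balanced d x
  | parallel T₁ T₂, x => T₁.Balanced d x ∧ T₂.Balanced d x ∧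
      (0 < T₁.value x → T₁.maxCost d x ≤ T₂.entryCost d x) ∧
      (0 < T₂.value x → T₂.maxCost d x ≤ T₁.entryCost d x)

/-- A lower bound for the change of the potential of one arc when its load changes from `x`
to `y`. -/
def marginal (d : ℕ → ℝ) (x y : ℕ) : ℝ :=
  ((y - x : ℕ) : ℝ) * d (x + 1) - ((x - y : ℕ) : ℝ) * d x

variable {d : E → ℕ → ℝ}

theorem entryCost_mono (hd : ∀ e, Monotone (d e)) (T : SPTree E) {x y : E → ℕ}
    (h : ∀ e, x e ≤ y e) : T.entryCost d x ≤ T.entryCost d y := by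
  induction T with
  | arc e => exact hd e (Nat.add_le_add_right (h e) 1)
  | series T₁ T₂ h₁ h₂ => exact add_le_add h₁ h₂
  | parallel T₁ T₂ h₁ h₂ => exact min_le_min h₁ h₂

theorem value_zero (T : SPTree E) : T.value (fun _ => 0) = 0 := by
  induction T <;> simp_all [value]

theorem isFlow_zero (T : SPTree E) : T.IsFlow fun _ => 0 := by
  induction T <;> simp_all [IsFlow, value_zero]

theorem balanced_zero (T : SPTree E) : T.Balanced d fun _ => 0 := by
  induction T <;> simp_all [Balanced, value_zero]

variable [DecidableEq E]

/-- The arcs of a decomposition tree. -/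
def edges : SPTree E → Finset E
  | arc e => {e}
  | series T₁ T₂ => T₁.edges ∪ T₂.edges
  | parallel T₁ T₂ => T₁.edges ∪ T₂.edges

/-- The arc sets of the paths from origin to destination. -/
def paths : SPTree E → Set (Finset E)
  | arc e => {{e}}
  | series T₁ T₂ => {a | ∃ a₁ ∈ T₁.paths, ∃ a₂ ∈ T₂.paths, a = a₁ ∪ a₂}
  | parallel T₁ T₂ => T₁.paths ∪ T₂.paths

/-- No arc occurs twice in the tree. -/
def WellFormed : SPTree E → Prop
  | arc _ => True
  | series T₁ T₂ => T₁.WellFormed ∧ T₂.WellFormed ∧ Disjoint T₁.edges T₂.edges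
  | parallel T₁ T₂ => T₁.WellFormed ∧ T₂.WellFormed ∧ Disjoint T₁.edges T₂.edges

theorem subset_edges (T : SPTree E) {a : Finset E} (ha : a ∈ T.paths) : a ⊆ T.edges := by
  induction T generalizing a with
  | arc e => simp_all [edges, paths]
  | series T₁ T₂ h₁ h₂ =>
    obtain ⟨a₁, ha₁, a₂, ha₂, rfl⟩ := ha
    exact Finset.union_subset_union (h₁ ha₁) (h₂ ha₂)
  | parallel T₁ T₂ h₁ h₂ =>
    rcases ha with ha | ha
    · exact (h₁ ha).trans Finset.subset_union_left
    · exact (h₂ ha).trans Finset.subset_union_right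

theorem value_congr (T : SPTree E) {x y : E → ℕ} (h : ∀ e ∈ T.edges, x e = y e) :
    T.value x = T.value y := by
  induction T with
  | arc e => exact h e (by simp [edges])
  | series T₁ T₂ h₁ h₂ => exact h₁ fun e he => h e (by simp [edges, he])
  | parallel T₁ T₂ h₁ h₂ =>
    exact congrArg₂ (· + ·) (h₁ fun e he => h e (by simp [edges, he]))
      (h₂ fun e he => h e (by simp [edges, he]))

theorem isFlow_congr (T : SPTree E) {x y : E → ℕ} (h : ∀ e ∈ T.edges, x e = y e)
    (hx : T.IsFlow x) : T.IsFlow y := by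
  induction T with
  | arc e => trivial
  | series T₁ T₂ h₁ h₂ =>
    have e₁ : ∀ e ∈ T₁.edges, x e = y e := fun e he => h e (by simp [edges, he])
    have e₂ : ∀ e ∈ T₂.edges, x e = y e := fun e he => h e (by simp [edges, he])
    refine ⟨h₁ e₁ hx.1, h₂ e₂ hx.2.1, ?_⟩
    rw [← T₁.value_congr e₁, ← T₂.value_congr e₂]
    exact hx.2.2
  | parallel T₁ T₂ h₁ h₂ =>
    exact ⟨h₁ (fun e he => h e (by simp [edges, he])) hx.1,
      h₂ (fun e he => h e (by simp [edges, he])) hx.2⟩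

theorem entryCost_congr (T : SPTree E) {x y : E → ℕ} (h : ∀ e ∈ T.edges, x e = y e) :
    T.entryCost d x = T.entryCost d y := by
  induction T with
  | arc e => simp [entryCost, h e (by simp [edges])]
  | series T₁ T₂ h₁ h₂ =>
    exact congrArg₂ (· + ·) (h₁ fun e he => h e (by simp [edges, he]))
      (h₂ fun e he => h e (by simp [edges, he]))
  | parallel T₁ T₂ h₁ h₂ =>
    exact congrArg₂ min (h₁ fun e he => h e (by simp [edges, he]))
      (h₂ fun e he => h e (by simp [edges, he]))

theorem maxCost_congr (T : SPTree E) {x y : E → ℕ} (h : ∀ e ∈ T.edges, x e = y e) :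
    T.maxCost d x = T.maxCost d y := by
  induction T with
  | arc e => simp [maxCost, h e (by simp [edges])]
  | series T₁ T₂ h₁ h₂ =>
    exact congrArg₂ (· + ·) (h₁ fun e he => h e (by simp [edges, he]))
      (h₂ fun e he => h e (by simp [edges, he]))
  | parallel T₁ T₂ h₁ h₂ =>
    have e₁ : ∀ e ∈ T₁.edges, x e = y e := fun e he => h e (by simp [edges, he])
    have e₂ : ∀ e ∈ T₂.edges, x e = y e := fun e he => h e (by simp [edges, he])
    simp only [maxCost, T₁.value_congr e₁, T₂.value_congr e₂, h₁ e₁, h₂ e₂]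

theorem balanced_congr (T : SPTree E) {x y : E → ℕ} (h : ∀ e ∈ T.edges, x e = y e)
    (hx : T.Balanced d x) : T.Balanced d y := by
  induction T with
  | arc e => trivial
  | series T₁ T₂ h₁ h₂ =>
    exact ⟨h₁ (fun e he => h e (by simp [edges, he])) hx.1,
      h₂ (fun e he => h e (by simp [edges, he])) hx.2⟩
  | parallel T₁ T₂ h₁ h₂ =>
    have e₁ : ∀ e ∈ T₁.edges, x e = y e := fun e he => h e (by simp [edges, he])
    have e₂ : ∀ e ∈ T₂.edges, x e = y e := fun e he => h e (by simp [edges, he])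
    obtain ⟨b₁, b₂, b₃, b₄⟩ := hx
    rw [T₁.value_congr e₁, T₁.maxCost_congr e₁, T₂.entryCost_congr e₂] at b₃
    rw [T₂.value_congr e₂, T₂.maxCost_congr e₂, T₁.entryCost_congr e₁] at b₄
    exact ⟨h₁ e₁ b₁, h₂ e₂ b₂, b₃, b₄⟩

theorem sum_series_path {T₁ T₂ : SPTree E} (h : Disjoint T₁.edges T₂.edges) {a₁ a₂ : Finset E}
    (h₁ : a₁ ∈ T₁.paths) (h₂ : a₂ ∈ T₂.paths) (f : E → ℝ) :
    ∑ e ∈ a₁ ∪ a₂, f e = ∑ e ∈ a₁, f e + ∑ e ∈ a₂, f e :=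
  Finset.sum_union (Finset.disjoint_of_subset_left (T₁.subset_edges h₁)
    (Finset.disjoint_of_subset_right (T₂.subset_edges h₂) h))

theorem entryCost_le (T : SPTree E) (hT : T.WellFormed) (x : E → ℕ) {a : Finset E}
    (ha : a ∈ T.paths) : T.entryCost d x ≤ ∑ e ∈ a, d e (x e + 1) := by
  induction T generalizing a with
  | arc e =>
    obtain rfl : a = {e} := ha
    simp [entryCost]
  | series T₁ T₂ h₁ h₂ =>
    obtain ⟨a₁, ha₁, a₂, ha₂, rfl⟩ := ha
    rw [sum_series_path hT.2.2 ha₁ ha₂]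
    exact add_le_add (h₁ hT.1 ha₁) (h₂ hT.2.1 ha₂)
  | parallel T₁ T₂ h₁ h₂ =>
    rcases ha with ha | ha
    · exact (min_le_left _ _).trans (h₁ hT.1 ha)
    · exact (min_le_right _ _).trans (h₂ hT.2.1 ha)

theorem exists_path_eq_entryCost (T : SPTree E) (hT : T.WellFormed) (x : E → ℕ) :
    ∃ a ∈ T.paths, ∑ e ∈ a, d e (x e + 1) = T.entryCost d x := by
  induction T with
  | arc e => exact ⟨{e}, rfl, by simp [entryCost]⟩
  | series T₁ T₂ h₁ h₂ =>
    obtain ⟨a₁, ha₁, e₁⟩ := h₁ hT.1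
    obtain ⟨a₂, ha₂, e₂⟩ := h₂ hT.2.1
    exact ⟨a₁ ∪ a₂, ⟨a₁, ha₁, a₂, ha₂, rfl⟩, by
      rw [sum_series_path hT.2.2 ha₁ ha₂, e₁, e₂, entryCost]⟩
  | parallel T₁ T₂ h₁ h₂ =>
    obtain ⟨a₁, ha₁, e₁⟩ := h₁ hT.1
    obtain ⟨a₂, ha₂, e₂⟩ := h₂ hT.2.1
    rcases le_total (T₁.entryCost d x) (T₂.entryCost d x) with h | h
    · exact ⟨a₁, Or.inl ha₁, by rw [e₁, entryCost, min_eq_left h]⟩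
    · exact ⟨a₂, Or.inr ha₂, by rw [e₂, entryCost, min_eq_right h]⟩

/-- The relation between `x` and `y` is required on the arcs of `T` only, so that it passes to the
subtrees, each of which sees just its own piece of the path. -/
theorem isFlow_add_path (T : SPTree E) (hT : T.WellFormed) {x y : E → ℕ} {a : Finset E}
    (ha : a ∈ T.paths) (hx : T.IsFlow x)
    (hy : ∀ e ∈ T.edges, y e = x e + if e ∈ a then 1 else 0) :
    T.IsFlow y ∧ T.value y = T.value x + 1 := by
  induction T generalizing a with
  | arc e =>
    obtain rfl : a = {e} := ha
    exact ⟨trivial, by simpa [edges, value] using hy⟩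
  | series T₁ T₂ h₁ h₂ =>
    obtain ⟨a₁, ha₁, a₂, ha₂, rfl⟩ := ha
    obtain ⟨w₁, w₂, w₃⟩ := hT
    have s₁ := T₁.subset_edges ha₁
    have s₂ := T₂.subset_edges ha₂
    obtain ⟨f₁, v₁⟩ := h₁ w₁ ha₁ hx.1 fun e he => by
      have : e ∉ a₂ := fun h => Finset.disjoint_left.1 w₃ he (s₂ h)
      simpa [this] using hy e (by simp [edges, he])
    obtain ⟨f₂, v₂⟩ := h₂ w₂ ha₂ hx.2.1 fun e he => by
      have : e ∉ a₁ := fun h => Finset.disjoint_left.1 w₃ (s₁ h) he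
      simpa [this] using hy e (by simp [edges, he])
    exact ⟨⟨f₁, f₂, by rw [v₁, v₂, hx.2.2]⟩, v₁⟩
  | parallel T₁ T₂ h₁ h₂ =>
    obtain ⟨w₁, w₂, w₃⟩ := hT
    rcases ha with ha | ha
    · obtain ⟨f₁, v₁⟩ := h₁ w₁ ha hx.1 fun e he => hy e (by simp [edges, he])
      have e₂ : ∀ e ∈ T₂.edges, x e = y e := fun e he => by
        have : e ∉ a := fun h => Finset.disjoint_left.1 w₃ (T₁.subset_edges ha h) he
        simp [hy e (by simp [edges, he]), this]
      refine ⟨⟨f₁, T₂.isFlow_congr e₂ hx.2⟩, ?_⟩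
      simp only [value, v₁, ← T₂.value_congr e₂]
      ring
    · obtain ⟨f₁, v₁⟩ := h₂ w₂ ha hx.2 fun e he => hy e (by simp [edges, he])
      have e₂ : ∀ e ∈ T₁.edges, x e = y e := fun e he => by
        have : e ∉ a := fun h => Finset.disjoint_left.1 w₃ he (T₂.subset_edges ha h)
        simp [hy e (by simp [edges, he]), this]
      refine ⟨⟨T₁.isFlow_congr e₂ hx.1, f₁⟩, ?_⟩
      simp only [value, v₁, ← T₁.value_congr e₂]
      ring

/-- Routing one more player along a cheapest path preserves balance. -/
theorem balanced_add_path (hd : ∀ e, Monotone (d e)) (T : SPTree E) (hT : T.WellFormed)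
    {x y : E → ℕ} {a : Finset E} (ha : a ∈ T.paths) (hf : T.IsFlow x) (hx : T.Balanced d x)
    (hmin : ∑ e ∈ a, d e (x e + 1) ≤ T.entryCost d x)
    (hy : ∀ e ∈ T.edges, y e = x e + if e ∈ a then 1 else 0) (hxy : ∀ e, x e ≤ y e) :
    T.Balanced d y ∧ T.maxCost d y ≤ T.entryCost d x := by
  induction T generalizing a with
  | arc e =>
    obtain rfl : a = {e} := ha
    refine ⟨trivial, ?_⟩
    have := hy e (by simp [edges])
    simp only [Finset.mem_singleton, if_true] at this
    simp [maxCost, entryCost, this]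
  | series T₁ T₂ h₁ h₂ =>
    obtain ⟨a₁, ha₁, a₂, ha₂, rfl⟩ := ha
    obtain ⟨w₁, w₂, w₃⟩ := hT
    have s₁ := T₁.subset_edges ha₁
    have s₂ := T₂.subset_edges ha₂
    rw [sum_series_path w₃ ha₁ ha₂, entryCost] at hmin
    -- Each piece costs at least the entry cost of its part; as the sum is at most the total entry
    -- cost, both pieces are cheapest.
    have l₁ := T₁.entryCost_le (d := d) w₁ x ha₁
    have l₂ := T₂.entryCost_le (d := d) w₂ x ha₂
    obtain ⟨f₁, v₁⟩ := h₁ w₁ ha₁ hf.1 hx.1 (by linarith) fun e he => by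
      have : e ∉ a₂ := fun h => Finset.disjoint_left.1 w₃ he (s₂ h)
      simpa [this] using hy e (by simp [edges, he])
    obtain ⟨f₂, v₂⟩ := h₂ w₂ ha₂ hf.2.1 hx.2 (by linarith) fun e he => by
      have : e ∉ a₁ := fun h => Finset.disjoint_left.1 w₃ (s₁ h) he
      simpa [this] using hy e (by simp [edges, he])
    exact ⟨⟨f₁, f₂⟩, add_le_add v₁ v₂⟩
  | parallel T₁ T₂ h₁ h₂ =>
    obtain ⟨w₁, w₂, w₃⟩ := hT
    obtain ⟨b₁, b₂, b₃, b₄⟩ := hx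
    rw [entryCost] at hmin
    rcases ha with ha | ha
    · have l₁ := T₁.entryCost_le (d := d) w₁ x ha
      obtain ⟨f₁, v₁⟩ := h₁ w₁ ha hf.1 b₁ (hmin.trans (min_le_left _ _))
        fun e he => hy e (by simp [edges, he])
      have e₂ : ∀ e ∈ T₂.edges, x e = y e := fun e he => by
        have : e ∉ a := fun h => Finset.disjoint_left.1 w₃ (T₁.subset_edges ha h) he
        simp [hy e (by simp [edges, he]), this]
      have hle : T₁.entryCost d x ≤ T₂.entryCost d x := l₁.trans (hmin.trans (min_le_right _ _))
      refine ⟨⟨f₁, T₂.balanced_congr e₂ b₂, fun _ => ?_, fun hpos => ?_⟩, ?_⟩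
      · rw [← T₂.entryCost_congr e₂]
        exact v₁.trans hle
      -- The used paths of the unchanged part keep their cost, while entering the other part has
      -- only become more expensive.
      · rw [← T₂.maxCost_congr e₂]
        rw [← T₂.value_congr e₂] at hpos
        exact (b₄ hpos).trans (T₁.entryCost_mono hd hxy)
      · rw [entryCost, min_eq_left hle, maxCost, ← T₂.value_congr e₂, ← T₂.maxCost_congr e₂]
        -- The part that received the player carries flow, so its `maxCost` is not a junk value.
        have hv : T₁.value y ≠ 0 := by
          rw [(T₁.isFlow_add_path w₁ ha hf.1 fun e he => hy e (by simp [edges, he])).2]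
          exact Nat.succ_ne_zero _
        rw [if_neg hv]
        split_ifs with h0
        · exact v₁
        · exact max_le v₁ (b₄ (Nat.pos_of_ne_zero h0))
    · have l₂ := T₂.entryCost_le (d := d) w₂ x ha
      obtain ⟨f₂, v₂⟩ := h₂ w₂ ha hf.2 b₂ (hmin.trans (min_le_right _ _))
        fun e he => hy e (by simp [edges, he])
      have e₁ : ∀ e ∈ T₁.edges, x e = y e := fun e he => by
        have : e ∉ a := fun h => Finset.disjoint_left.1 w₃ he (T₂.subset_edges ha h)
        simp [hy e (by simp [edges, he]), this]
      have hle : T₂.entryCost d x ≤ T₁.entryCost d x := l₂.trans (hmin.trans (min_le_left _ _))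
      refine ⟨⟨T₁.balanced_congr e₁ b₁, f₂, fun hpos => ?_, fun _ => ?_⟩, ?_⟩
      · rw [← T₁.maxCost_congr e₁]
        rw [← T₁.value_congr e₁] at hpos
        exact (b₃ hpos).trans (T₂.entryCost_mono hd hxy)
      · rw [← T₁.entryCost_congr e₁]
        exact v₂.trans hle
      · rw [entryCost, min_eq_right hle, maxCost, ← T₁.value_congr e₁, ← T₁.maxCost_congr e₁]
        have hv : T₂.value y ≠ 0 := by
          rw [(T₂.isFlow_add_path w₂ ha hf.2 fun e he => hy e (by simp [edges, he])).2]
          exact Nat.succ_ne_zero _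
        rw [if_neg hv]
        split_ifs with h0
        · exact v₂
        · exact max_le (b₃ (Nat.pos_of_ne_zero h0)) v₂

/-- Here `n` and `m` stand for old and new flow values, `p` for entry costs and `q` for largest used
costs. If one part gains and the other loses, the units that merely switch parts contribute an entry
cost minus a used cost, which is nonnegative by balance. The net change is compared with `min p₁ p₂`
for gains and with `q` for losses. -/
theorem marginal_add_le {n₁ n₂ m₁ m₂ : ℕ} {p₁ p₂ q₁ q₂ q : ℝ} (h₁ : 0 < n₁ → q₁ ≤ p₂)
    (h₂ : 0 < n₂ → q₂ ≤ p₁) (hq₁ : 0 < n₁ → q₁ ≤ q) (hq₂ : 0 < n₂ → q₂ ≤ q) :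
    ((m₁ + m₂ - (n₁ + n₂) : ℕ) : ℝ) * min p₁ p₂ - ((n₁ + n₂ - (m₁ + m₂) : ℕ) : ℝ) * q ≤
      (((m₁ - n₁ : ℕ) : ℝ) * p₁ - ((n₁ - m₁ : ℕ) : ℝ) * q₁) +
        (((m₂ - n₂ : ℕ) : ℝ) * p₂ - ((n₂ - m₂ : ℕ) : ℝ) * q₂) := by
  have l₁ := min_le_left p₁ p₂
  have l₂ := min_le_right p₁ p₂
  generalize min p₁ p₂ = p at *
  -- Removing a positive number `w` of units presupposes flow, which is when the conditional bounds
  -- are available.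
  have key {n w : ℕ} {s t : ℝ} (h : 0 < n → s ≤ t) (hw : w ≤ n) : (w : ℝ) * s ≤ w * t := by
    rcases Nat.eq_zero_or_pos w with rfl | h0
    · simp
    · exact mul_le_mul_of_nonneg_left (h (h0.trans_le hw)) (Nat.cast_nonneg w)
  have keyp {w : ℕ} {s t : ℝ} (h : s ≤ t) : (w : ℝ) * s ≤ w * t :=
    mul_le_mul_of_nonneg_left h (Nat.cast_nonneg w)
  rcases le_total n₁ m₁ with a | a <;> rcases le_total n₂ m₂ with b | b <;>
    obtain ⟨u, rfl⟩ := Nat.exists_eq_add_of_le a <;>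
    obtain ⟨v, rfl⟩ := Nat.exists_eq_add_of_le b
  · rw [show n₁ + u + (n₂ + v) - (n₁ + n₂) = u + v by omega,
      show n₁ + n₂ - (n₁ + u + (n₂ + v)) = 0 by omega]
    simp only [Nat.add_sub_cancel_left, Nat.sub_eq_zero_of_le a, Nat.sub_eq_zero_of_le b]
    push_cast
    linarith [keyp (w := u) l₁, keyp (w := v) l₂]
  · simp only [Nat.add_sub_cancel_left, Nat.sub_eq_zero_of_le a, Nat.sub_eq_zero_of_le b]
    rcases le_total v u with c | c <;> obtain ⟨w, rfl⟩ := Nat.exists_eq_add_of_le c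
    · rw [show n₁ + (v + w) + m₂ - (n₁ + (m₂ + v)) = w by omega,
        show n₁ + (m₂ + v) - (n₁ + (v + w) + m₂) = 0 by omega]
      push_cast
      linarith [keyp (w := w) l₁, key (w := v) h₂ (by omega)]
    · rw [show n₁ + u + m₂ - (n₁ + (m₂ + (u + w))) = 0 by omega,
        show n₁ + (m₂ + (u + w)) - (n₁ + u + m₂) = w by omega]
      push_cast
      linarith [key (w := u) h₂ (by omega), key (w := w) hq₂ (by omega)]
  · simp only [Nat.add_sub_cancel_left, Nat.sub_eq_zero_of_le a, Nat.sub_eq_zero_of_le b]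
    rcases le_total u v with c | c <;> obtain ⟨w, rfl⟩ := Nat.exists_eq_add_of_le c
    · rw [show m₁ + (n₂ + (u + w)) - (m₁ + u + n₂) = w by omega,
        show m₁ + u + n₂ - (m₁ + (n₂ + (u + w))) = 0 by omega]
      push_cast
      linarith [keyp (w := w) l₂, key (w := u) h₁ (by omega)]
    · rw [show m₁ + (n₂ + v) - (m₁ + (v + w) + n₂) = 0 by omega,
        show m₁ + (v + w) + n₂ - (m₁ + (n₂ + v)) = w by omega]
      push_cast
      linarith [key (w := v) h₁ (by omega), key (w := w) hq₁ (by omega)]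
  · rw [show m₁ + m₂ - (m₁ + u + (m₂ + v)) = 0 by omega,
      show m₁ + u + (m₂ + v) - (m₁ + m₂) = u + v by omega]
    simp only [Nat.add_sub_cancel_left, Nat.sub_eq_zero_of_le a, Nat.sub_eq_zero_of_le b]
    push_cast
    linarith [key (w := u) hq₁ (by omega), key (w := v) hq₂ (by omega)]

/-- A balanced flow is a minimum of the potential: moving from the load `x` to the load `y` of
another flow changes the potential by at least the change of the value times the marginal cost of
a player. -/
theorem le_sum_marginal (T : SPTree E) (hT : T.WellFormed) {x y : E → ℕ} (hx : T.IsFlow x)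
    (hb : T.Balanced d x) (hy : T.IsFlow y) :
    ((T.value y - T.value x : ℕ) : ℝ) * T.entryCost d x -
        ((T.value x - T.value y : ℕ) : ℝ) * T.maxCost d x ≤
      ∑ e ∈ T.edges, marginal (d e) (x e) (y e) := by
  induction T with
  | arc e => simp [edges, marginal, value, entryCost, maxCost]
  | series T₁ T₂ h₁ h₂ =>
    have := h₁ hT.1 hx.1 hb.1 hy.1
    have h := h₂ hT.2.1 hx.2.1 hb.2 hy.2.1
    -- Flow conservation gives both parts the same coefficients, so the two estimates simply add.
    rw [← hx.2.2, ← hy.2.2] at h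
    rw [edges, Finset.sum_union hT.2.2]
    simp only [value, entryCost, maxCost]
    linarith
  | parallel T₁ T₂ h₁ h₂ =>
    have := h₁ hT.1 hx.1 hb.1 hy.1
    have h := h₂ hT.2.1 hx.2 hb.2.1 hy.2
    rw [edges, Finset.sum_union hT.2.2]
    refine le_trans ?_ (add_le_add this h)
    refine marginal_add_le hb.2.2.1 hb.2.2.2 (fun h => ?_) (fun h => ?_)
    · rw [maxCost, if_neg h.ne']
      split_ifs
      · exact le_rfl
      · exact le_max_left _ _
    · rw [maxCost, if_neg h.ne']
      split_ifs
      · exact le_rfl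
      · exact le_max_right _ _

end SPTree

/-! ### Walks in series-parallel networks and their decomposition trees. -/

namespace Network

variable {V E : Type*} {Γ : Network V E}

/-- The arc sets of the walks from `s` to `t` that use only arcs in `F`. -/
def walkSets (Γ : Network V E) (s t : V) (F : Set E) : Set (Finset E) :=
  {a | ∃ p : List E, Γ.IsWalk s p t ∧ (∀ e ∈ p, e ∈ F) ∧ ∀ e, e ∈ a ↔ e ∈ p}

theorem src_mem_endpoints {F : Set E} {e : E} (he : e ∈ F) : Γ.src e ∈ Γ.endpoints F :=
  Or.inl ⟨e, he, rfl⟩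

theorem tgt_mem_endpoints {F : Set E} {e : E} (he : e ∈ F) : Γ.tgt e ∈ Γ.endpoints F :=
  Or.inr ⟨e, he, rfl⟩

theorem isWalk_append {s m t : V} {p q : List E} (hp : Γ.IsWalk s p m) (hq : Γ.IsWalk m q t) :
    Γ.IsWalk s (p ++ q) t := by
  induction p generalizing s with
  | nil =>
    obtain rfl : s = m := hp
    exact hq
  | cons e p ih => exact ⟨hp.1, ih hp.2⟩

namespace SeriesParallelOn

/-- The absence of arcs into the origin and out of the destination is what prevents a walk from
switching back between the parts of a composition. -/
theorem terminals {s t : V} {F : Set E} (h : Γ.SeriesParallelOn s t F) :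
    s ∈ Γ.endpoints F ∧ t ∈ Γ.endpoints F ∧ s ≠ t ∧
      (∀ e ∈ F, Γ.tgt e ≠ s) ∧ ∀ e ∈ F, Γ.src e ≠ t := by
  induction h with
  | arc e he =>
    exact ⟨src_mem_endpoints rfl, tgt_mem_endpoints rfl, he,
      fun f hf => by rw [Set.mem_singleton_iff.1 hf]; exact he.symm,
      fun f hf => by rw [Set.mem_singleton_iff.1 hf]; exact he⟩
  | series s m t F₁ F₂ _ _ _ hV h₁ h₂ =>
    obtain ⟨a₁, b₁, c₁, d₁, e₁⟩ := h₁
    obtain ⟨a₂, b₂, c₂, d₂, e₂⟩ := h₂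
    have common {v : V} (hv₁ : v ∈ Γ.endpoints F₁) (hv₂ : v ∈ Γ.endpoints F₂) : v = m := by
      have : v ∈ Γ.endpoints F₁ ∩ Γ.endpoints F₂ := ⟨hv₁, hv₂⟩
      rwa [hV] at this
    have hs {v : V} (hv : v ∈ Γ.endpoints F₂) : v ≠ s := by
      rintro rfl
      exact c₁ (common a₁ hv)
    have ht {v : V} (hv : v ∈ Γ.endpoints F₁) : v ≠ t := by
      rintro rfl
      exact c₂ (common hv b₂).symm
    refine ⟨?_, ?_, (hs b₂).symm, ?_, ?_⟩
    · exact a₁.imp (Set.image_mono Set.subset_union_left ·) (Set.image_mono Set.subset_union_left ·)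
    · exact b₂.imp (Set.image_mono Set.subset_union_right ·)
        (Set.image_mono Set.subset_union_right ·)
    · rintro e (he | he)
      · exact d₁ e he
      · exact hs (tgt_mem_endpoints he)
    · rintro e (he | he)
      · exact ht (src_mem_endpoints he)
      · exact e₂ e he
  | parallel s t F₁ F₂ _ _ _ _ h₁ h₂ =>
    obtain ⟨a₁, b₁, c₁, d₁, e₁⟩ := h₁
    obtain ⟨a₂, b₂, c₂, d₂, e₂⟩ := h₂
    refine ⟨?_, ?_, c₁, ?_, ?_⟩
    · exact a₁.imp (Set.image_mono Set.subset_union_left ·) (Set.image_mono Set.subset_union_left ·)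
    · exact b₁.imp (Set.image_mono Set.subset_union_left ·) (Set.image_mono Set.subset_union_left ·)
    · rintro e (he | he)
      exacts [d₁ e he, d₂ e he]
    · rintro e (he | he)
      exacts [e₁ e he, e₂ e he]

theorem walk_arc {e : E} (he : Γ.src e ≠ Γ.tgt e) {p : List E}
    (hp : Γ.IsWalk (Γ.src e) p (Γ.tgt e)) (hF : ∀ f ∈ p, f ∈ ({e} : Set E)) : p = [e] := by
  match p with
  | [] => exact absurd hp he
  | [f] => rw [Set.mem_singleton_iff.1 (hF f (by simp))]
  | f :: g :: q =>
    have h := hp.2.1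
    rw [Set.mem_singleton_iff.1 (hF f (by simp)), Set.mem_singleton_iff.1 (hF g (by simp))] at h
    exact absurd h he

/-- The parts meet only in `m`, and no arc of `F₁` leaves `m`; hence a walk that has entered the
second part stays there. -/
theorem walk_series {s m t : V} {F₁ F₂ : Set E} (h₁ : Γ.SeriesParallelOn s m F₁)
    (h₂ : Γ.SeriesParallelOn m t F₂) (hV : Γ.endpoints F₁ ∩ Γ.endpoints F₂ = {m})
    {p : List E} (hp : Γ.IsWalk s p t) (hF : ∀ e ∈ p, e ∈ F₁ ∪ F₂) :
    ∃ p₁ p₂, p = p₁ ++ p₂ ∧ Γ.IsWalk s p₁ m ∧ (∀ e ∈ p₁, e ∈ F₁) ∧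
      Γ.IsWalk m p₂ t ∧ ∀ e ∈ p₂, e ∈ F₂ := by
  obtain ⟨a₁, b₁, c₁, d₁, e₁⟩ := h₁.terminals
  obtain ⟨a₂, b₂, c₂, d₂, e₂⟩ := h₂.terminals
  have common {v : V} (hv₁ : v ∈ Γ.endpoints F₁) (hv₂ : v ∈ Γ.endpoints F₂) : v = m := by
    have : v ∈ Γ.endpoints F₁ ∩ Γ.endpoints F₂ := ⟨hv₁, hv₂⟩
    rwa [hV] at this
  have second : ∀ (q : List E) (u : V), u ∈ Γ.endpoints F₂ → Γ.IsWalk u q t →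
      (∀ e ∈ q, e ∈ F₁ ∪ F₂) → ∀ e ∈ q, e ∈ F₂ := by
    intro q
    induction q with
    | nil => simp
    | cons e q ih =>
      intro u hu hw hq
      have he : e ∈ F₂ := by
        refine (hq e (by simp)).resolve_left fun he => e₁ e he (common (src_mem_endpoints he) ?_)
        rw [hw.1]
        exact hu
      have := ih _ (tgt_mem_endpoints he) hw.2 fun f hf => hq f (by simp [hf])
      simpa [he] using this
  have first : ∀ (q : List E) (u : V), u ∈ Γ.endpoints F₁ → Γ.IsWalk u q t →
      (∀ e ∈ q, e ∈ F₁ ∪ F₂) → ∃ p₁ p₂, q = p₁ ++ p₂ ∧ Γ.IsWalk u p₁ m ∧ (∀ e ∈ p₁, e ∈ F₁) ∧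
      Γ.IsWalk m p₂ t ∧ ∀ e ∈ p₂, e ∈ F₂ := by
    intro q
    induction q with
    | nil =>
      intro u hu hw
      obtain rfl : u = t := hw
      exact absurd (common hu b₂).symm c₂
    | cons e q ih =>
      intro u hu hw hq
      rcases hq e (by simp) with he | he
      · obtain ⟨p₁, p₂, rfl, i₁, i₂, i₃, i₄⟩ :=
          ih _ (tgt_mem_endpoints he) hw.2 fun f hf => hq f (by simp [hf])
        exact ⟨e :: p₁, p₂, rfl, ⟨hw.1, i₁⟩, by simpa [he] using i₂, i₃, i₄⟩
      · obtain rfl : u = m := common hu (by rw [← hw.1]; exact src_mem_endpoints he)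
        exact ⟨[], e :: q, rfl, rfl, by simp, hw, second _ _ a₂ hw hq⟩
  exact first p s a₁ hp hF

/-- A walk could change parts only at `s` or `t`, but it cannot return to `s` and cannot leave `t`.
-/
theorem walk_parallel {s t : V} {F₁ F₂ : Set E} (h₁ : Γ.SeriesParallelOn s t F₁)
    (h₂ : Γ.SeriesParallelOn s t F₂) (hV : Γ.endpoints F₁ ∩ Γ.endpoints F₂ = {s, t})
    {p : List E} (hp : Γ.IsWalk s p t) (hF : ∀ e ∈ p, e ∈ F₁ ∪ F₂) :
    (∀ e ∈ p, e ∈ F₁) ∨ ∀ e ∈ p, e ∈ F₂ := by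
  have stay : ∀ F₁ F₂ : Set E, Γ.SeriesParallelOn s t F₁ → Γ.SeriesParallelOn s t F₂ →
      Γ.endpoints F₁ ∩ Γ.endpoints F₂ = {s, t} → ∀ (q : List E) (u : V), u ≠ s →
      u ∈ Γ.endpoints F₁ → Γ.IsWalk u q t → (∀ e ∈ q, e ∈ F₁ ∪ F₂) → ∀ e ∈ q, e ∈ F₁ := by
    intro F₁ F₂ h₁ h₂ hV q
    induction q with
    | nil => simp
    | cons e q ih =>
      intro u hus hu hw hq
      have he : e ∈ F₁ := by
        refine (hq e (by simp)).resolve_right fun he => ?_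
        have : u ∈ Γ.endpoints F₁ ∩ Γ.endpoints F₂ :=
          ⟨hu, by rw [← hw.1]; exact src_mem_endpoints he⟩
        rw [hV] at this
        exact h₂.terminals.2.2.2.2 e he (hw.1.trans (this.resolve_left hus))
      have := ih _ (h₁.terminals.2.2.2.1 e he) (tgt_mem_endpoints he) hw.2
        fun f hf => hq f (by simp [hf])
      simpa [he] using this
  match p with
  | [] => simp
  | e :: q =>
    have hq : ∀ f ∈ q, f ∈ F₁ ∪ F₂ := fun f hf => hF f (by simp [hf])
    rcases hF e (by simp) with he | he
    · left
      have := stay F₁ F₂ h₁ h₂ hV q _ (h₁.terminals.2.2.2.1 e he) (tgt_mem_endpoints he) hp.2 hq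
      simpa [he] using this
    · right
      have := stay F₂ F₁ h₂ h₁ (by rw [Set.inter_comm, hV]) q _ (h₂.terminals.2.2.2.1 e he)
        (tgt_mem_endpoints he) hp.2 (by rwa [Set.union_comm])
      simpa [he] using this

/-- Every walk between the terminals is thus a path, which lets `walkSets` replace `pathSets`; walks
are easier to cut and concatenate. -/
theorem nodup_walk {s t : V} {F : Set E} (h : Γ.SeriesParallelOn s t F) {p : List E}
    (hp : Γ.IsWalk s p t) (hF : ∀ e ∈ p, e ∈ F) : (s :: p.map Γ.tgt).Nodup := by
  induction h generalizing p with
  | arc e he =>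
    rw [walk_arc he hp hF]
    simpa using he
  | series s m t F₁ F₂ h₁ h₂ _ hV i₁ i₂ =>
    obtain ⟨p₁, p₂, rfl, w₁, f₁, w₂, f₂⟩ := walk_series h₁ h₂ hV hp hF
    rw [List.map_append, ← List.cons_append]
    refine List.Nodup.append (i₁ w₁ f₁) (List.nodup_cons.1 (i₂ w₂ f₂)).2 fun v hv hv' => ?_
    obtain ⟨e, he, rfl⟩ := List.mem_map.1 hv'
    have : Γ.tgt e ∈ Γ.endpoints F₁ := by
      rcases List.mem_cons.1 hv with hv | hv
      · rw [hv]
        exact h₁.terminals.1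
      · obtain ⟨f, hf, hfe⟩ := List.mem_map.1 hv
        rw [← hfe]
        exact tgt_mem_endpoints (f₁ f hf)
    have : Γ.tgt e ∈ Γ.endpoints F₁ ∩ Γ.endpoints F₂ := ⟨this, tgt_mem_endpoints (f₂ e he)⟩
    rw [hV] at this
    exact h₂.terminals.2.2.2.1 e (f₂ e he) this
  | parallel s t F₁ F₂ h₁ h₂ _ hV i₁ i₂ =>
    rcases walk_parallel h₁ h₂ hV hp hF with hF | hF
    exacts [i₁ hp hF, i₂ hp hF]

theorem walkSets_arc {e : E} (he : Γ.src e ≠ Γ.tgt e) :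
    Γ.walkSets (Γ.src e) (Γ.tgt e) {e} = {{e}} := by
  ext a
  constructor
  · rintro ⟨p, hp, hF, ha⟩
    rw [walk_arc he hp hF] at ha
    ext f
    simpa using ha f
  · rintro rfl
    exact ⟨[e], ⟨rfl, rfl⟩, by simp, by simp⟩

theorem walkSets_series [DecidableEq E] {s m t : V} {F₁ F₂ : Set E}
    (h₁ : Γ.SeriesParallelOn s m F₁) (h₂ : Γ.SeriesParallelOn m t F₂)
    (hV : Γ.endpoints F₁ ∩ Γ.endpoints F₂ = {m}) :
    Γ.walkSets s t (F₁ ∪ F₂) =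
      {a | ∃ a₁ ∈ Γ.walkSets s m F₁, ∃ a₂ ∈ Γ.walkSets m t F₂, a = a₁ ∪ a₂} := by
  ext a
  constructor
  · rintro ⟨p, hp, hF, ha⟩
    obtain ⟨p₁, p₂, rfl, w₁, f₁, w₂, f₂⟩ := walk_series h₁ h₂ hV hp hF
    refine ⟨p₁.toFinset, ⟨p₁, w₁, f₁, by simp⟩, p₂.toFinset, ⟨p₂, w₂, f₂, by simp⟩, ?_⟩
    ext e
    simpa using ha e
  · rintro ⟨a₁, ⟨p₁, w₁, f₁, m₁⟩, a₂, ⟨p₂, w₂, f₂, m₂⟩, rfl⟩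
    refine ⟨p₁ ++ p₂, isWalk_append w₁ w₂, fun e he => ?_, fun e => by simp [m₁, m₂]⟩
    exact (List.mem_append.1 he).imp (f₁ e) (f₂ e)

theorem walkSets_parallel {s t : V} {F₁ F₂ : Set E}
    (h₁ : Γ.SeriesParallelOn s t F₁) (h₂ : Γ.SeriesParallelOn s t F₂)
    (hV : Γ.endpoints F₁ ∩ Γ.endpoints F₂ = {s, t}) :
    Γ.walkSets s t (F₁ ∪ F₂) = Γ.walkSets s t F₁ ∪ Γ.walkSets s t F₂ := by
  ext a
  constructor
  · rintro ⟨p, hp, hF, ha⟩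
    exact (walk_parallel h₁ h₂ hV hp hF).imp (fun h => ⟨p, hp, h, ha⟩) fun h => ⟨p, hp, h, ha⟩
  · rintro (⟨p, hp, hF, ha⟩ | ⟨p, hp, hF, ha⟩)
    · exact ⟨p, hp, fun e he => Or.inl (hF e he), ha⟩
    · exact ⟨p, hp, fun e he => Or.inr (hF e he), ha⟩

theorem exists_tree [DecidableEq E] {s t : V} {F : Set E} (h : Γ.SeriesParallelOn s t F) :
    ∃ T : SPTree E, T.WellFormed ∧ (T.edges : Set E) = F ∧ T.paths = Γ.walkSets s t F := by
  induction h with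
  | arc e he => exact ⟨.arc e, trivial, by simp [SPTree.edges], (walkSets_arc he).symm⟩
  | series s m t F₁ F₂ h₁ h₂ hd hV i₁ i₂ =>
    obtain ⟨T₁, w₁, rfl, p₁⟩ := i₁
    obtain ⟨T₂, w₂, rfl, p₂⟩ := i₂
    refine ⟨.series T₁ T₂, ⟨w₁, w₂, Finset.disjoint_coe.1 hd⟩, by simp [SPTree.edges], ?_⟩
    rw [walkSets_series h₁ h₂ hV, ← p₁, ← p₂, SPTree.paths]
  | parallel s t F₁ F₂ h₁ h₂ hd hV i₁ i₂ =>
    obtain ⟨T₁, w₁, rfl, p₁⟩ := i₁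
    obtain ⟨T₂, w₂, rfl, p₂⟩ := i₂
    refine ⟨.parallel T₁ T₂, ⟨w₁, w₂, Finset.disjoint_coe.1 hd⟩, by simp [SPTree.edges], ?_⟩
    rw [walkSets_parallel h₁ h₂ hV, ← p₁, ← p₂, SPTree.paths]

end SeriesParallelOn

theorem IsSeriesParallel.pathSets_eq (h : Γ.IsSeriesParallel) :
    Γ.pathSets = Γ.walkSets Γ.origin Γ.dest Set.univ := by
  ext a
  constructor
  · rintro ⟨p, hp, ha⟩
    exact ⟨p, hp.1, by simp, ha⟩
  · rintro ⟨p, hp, hF, ha⟩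
    exact ⟨p, ⟨hp, SeriesParallelOn.nodup_walk h hp hF⟩, ha⟩

theorem IsSeriesParallel.exists_tree [DecidableEq E] (h : Γ.IsSeriesParallel) :
    ∃ T : SPTree E, T.WellFormed ∧ (T.edges : Set E) = Set.univ ∧ T.paths = Γ.pathSets := by
  rw [h.pathSets_eq]
  exact SeriesParallelOn.exists_tree h

end Network

/-! ### Greedy sequential routing. -/

section Greedy

variable {N E : Type*} [DecidableEq E]

/-- The number of players in `s` that use the arc `e`. -/
def load (s : Finset N) (A : N → Finset E) (e : E) : ℕ :=
  {i ∈ s | e ∈ A i}.card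

theorem load_insert [DecidableEq N] {s : Finset N} {i : N} (hi : i ∉ s) (A : N → Finset E) (e : E) :
    load (insert i s) A e = load s A e + if e ∈ A i then 1 else 0 := by
  unfold load
  rw [Finset.filter_insert]
  split_ifs with h
  · rw [Finset.card_insert_of_notMem (by simp [hi])]
  · rfl

theorem load_congr {s : Finset N} {A B : N → Finset E} (h : ∀ i ∈ s, A i = B i) (e : E) :
    load s A e = load s B e := by
  unfold load
  rw [Finset.filter_congr fun i hi => by rw [h i hi]]

theorem SPTree.isFlow_load (T : SPTree E) (hT : T.WellFormed) {A : N → Finset E}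
    (hA : ∀ i, A i ∈ T.paths) (s : Finset N) :
    T.IsFlow (load s A) ∧ T.value (load s A) = s.card := by
  classical
  induction s using Finset.induction_on with
  | empty => exact ⟨T.isFlow_zero, T.value_zero⟩
  | insert i s hi ih =>
    have := T.isFlow_add_path hT (hA i) ih.1 fun e _ => load_insert hi A e
    rwa [ih.2, ← Finset.card_insert_of_notMem hi] at this

variable [Fintype N]

/-- Each player in turn, in the order given by the ranks `σ`, chooses a cheapest set in `P` given
the choices of the players before him. -/
def IsGreedy (d : E → ℕ → ℝ) (P : Set (Finset E)) (σ : N → ℕ) (A : N → Finset E) : Prop :=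
  ∀ i, ∀ a ∈ P, ∑ e ∈ A i, d e (load {j | σ j < σ i} A e + 1) ≤
    ∑ e ∈ a, d e (load {j | σ j < σ i} A e + 1)

variable {d : E → ℕ → ℝ}

theorem SPTree.balanced_load (hd : ∀ e, Monotone (d e)) (T : SPTree E) (hT : T.WellFormed)
    {σ : N → ℕ} (hσ : Function.Injective σ) {A : N → Finset E} (hA : ∀ i, A i ∈ T.paths)
    (hG : IsGreedy d T.paths σ A) (k : ℕ) : T.Balanced d (load {j | σ j < k} A) := by
  classical
  induction k with
  | zero =>
    have h0 : load ({j | σ j < 0} : Finset N) A = fun _ => 0 := by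
      funext e
      simp [load]
    rw [h0]
    exact T.balanced_zero
  | succ k ih =>
    -- Ranks may have gaps: passing from `k` to `k + 1` adds one player or none.
    by_cases h : ∃ i, σ i = k
    · obtain ⟨i, rfl⟩ := h
      have hs : Finset.univ.filter (fun j => σ j < σ i + 1) =
          insert i (Finset.univ.filter fun j => σ j < σ i) := by
        ext j
        simp only [Finset.mem_filter_univ, Finset.mem_insert, Nat.lt_succ_iff_lt_or_eq, hσ.eq_iff]
        tauto
      have hl := load_insert (s := {j | σ j < σ i}) (i := i) (by simp) A
      rw [hs]
      obtain ⟨a, ha, hae⟩ := T.exists_path_eq_entryCost (d := d) hT (load {j | σ j < σ i} A)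
      exact (T.balanced_add_path hd hT (hA i) (T.isFlow_load hT hA _).1 ih
        ((hG i a ha).trans hae.le) (fun e _ => hl e) fun e => by rw [hl]; exact Nat.le_add_right _ _).1
    · have hs : ({j | σ j < k + 1} : Finset N) = ({j | σ j < k} : Finset N) := by
        ext j
        have : σ j ≠ k := fun hj => h ⟨j, hj⟩
        simp only [Finset.mem_filter_univ]
        omega
      rwa [hs]

/-- Both profiles route all players, so the two flows have equal value and the left side of
`le_sum_marginal` vanishes. -/
theorem SPTree.sum_marginal_nonneg (hd : ∀ e, Monotone (d e)) (T : SPTree E) (hT : T.WellFormed)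
    {σ : N → ℕ} (hσ : Function.Injective σ) {A B : N → Finset E} (hA : ∀ i, A i ∈ T.paths)
    (hG : IsGreedy d T.paths σ A) (hB : ∀ i, B i ∈ T.paths) :
    0 ≤ ∑ e ∈ T.edges, marginal (d e) (load Finset.univ A e) (load Finset.univ B e) := by
  have hb := T.balanced_load hd hT hσ hA hG (Finset.univ.sup σ + 1)
  have hs : ({j | σ j < Finset.univ.sup σ + 1} : Finset N) = Finset.univ := by
    ext j
    simpa [Nat.lt_succ_iff] using Finset.le_sup (f := σ) (Finset.mem_univ j)
  rw [hs] at hb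
  obtain ⟨fA, vA⟩ := T.isFlow_load hT hA Finset.univ
  obtain ⟨fB, vB⟩ := T.isFlow_load hT hB Finset.univ
  have := T.le_sum_marginal hT fA hb fB
  simpa [vA, vB] using this

theorem SPTree.exists_isGreedy (T : SPTree E) (hT : T.WellFormed) {σ : N → ℕ}
    (hσ : Function.Injective σ) :
    ∃ A : N → Finset E, (∀ i, A i ∈ T.paths) ∧ IsGreedy d T.paths σ A := by
  classical
  suffices h : ∀ k, ∃ A : N → Finset E, (∀ i, A i ∈ T.paths) ∧ ∀ i, σ i < k → ∀ a ∈ T.paths,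
      ∑ e ∈ A i, d e (load {j | σ j < σ i} A e + 1) ≤
        ∑ e ∈ a, d e (load {j | σ j < σ i} A e + 1) by
    obtain ⟨A, hA, h⟩ := h (Finset.univ.sup σ + 1)
    exact ⟨A, hA, fun i => h i (Nat.lt_succ_of_le (Finset.le_sup (Finset.mem_univ i)))⟩
  intro k
  induction k with
  | zero =>
    obtain ⟨a, ha, -⟩ := T.exists_path_eq_entryCost (d := d) hT fun _ => 0
    exact ⟨fun _ => a, fun _ => ha, by simp⟩
  | succ k ih =>
    obtain ⟨A, hA, h⟩ := ih
    by_cases hk : ∃ i, σ i = k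
    · obtain ⟨i, rfl⟩ := hk
      obtain ⟨a, ha, hae⟩ := T.exists_path_eq_entryCost (d := d) hT (load {j | σ j < σ i} A)
      -- Changing the action of `i` does not affect what `i` and the players before him have
      -- observed, so their choices remain optimal.
      have hl : ∀ j, σ j ≤ σ i → load {l | σ l < σ j} (Function.update A i a) =
          load {l | σ l < σ j} A := fun j hj => by
        funext e
        refine load_congr (fun l hl => ?_) e
        rw [Function.update_of_ne]
        rintro rfl
        exact absurd hj (not_le.2 (Finset.mem_filter.1 hl).2)
      refine ⟨Function.update A i a, fun j => ?_, fun j hj b hb => ?_⟩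
      · by_cases hji : j = i
        · simpa [hji] using ha
        · simpa [hji] using hA j
      · rw [hl j (Nat.lt_succ_iff.1 hj)]
        by_cases hji : j = i
        · subst hji
          rw [Function.update_self, hae]
          exact T.entryCost_le hT _ hb
        · rw [Function.update_of_ne hji]
          exact h j (lt_of_le_of_ne (Nat.lt_succ_iff.1 hj) fun h => hji (hσ h)) b hb
    · refine ⟨A, hA, fun i hi => h i ?_⟩
      have : σ i ≠ k := fun hj => hk ⟨i, hj⟩
      omega

end Greedy

/-! ### Loads, costs and `1`-lookahead outcomes. -/

namespace CongestionGame

variable {N E : Type*} [Fintype N] [DecidableEq E]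

theorem congestion_eq_load (G : CongestionGame N E) (A : G.Profile) (e : E) :
    G.congestion A e = load Finset.univ (fun i => (A i : Finset E)) e := by
  unfold congestion load
  rw [← Set.ncard_coe_finset]
  congr 1
  ext i
  simp

theorem coe_cost (G : CongestionGame N E) (A : G.Profile) (i : N) :
    (G.cost A i : ℝ) = ∑ e ∈ (A i : Finset E),
      (G.delay e (load Finset.univ (fun i => (A i : Finset E)) e) : ℝ) := by
  simp [cost, congestion_eq_load]

theorem coe_socialCost [Fintype E] (G : CongestionGame N E) (A : G.Profile) :
    (G.socialCost A : ℝ) = ∑ e, (load Finset.univ (fun i => (A i : Finset E)) e : ℝ) *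
      (G.delay e (load Finset.univ (fun i => (A i : Finset E)) e) : ℝ) := by
  unfold socialCost
  push_cast
  simp only [coe_cost]
  have : ∀ i, ∑ e ∈ (A i : Finset E),
      (G.delay e (load Finset.univ (fun i => (A i : Finset E)) e) : ℝ) =
      ∑ e, if e ∈ (A i : Finset E) then
        (G.delay e (load Finset.univ (fun i => (A i : Finset E)) e) : ℝ) else 0 := fun i => by
    rw [Finset.sum_ite_mem, Finset.univ_inter]
  simp only [this]
  rw [Finset.sum_comm]
  refine Finset.sum_congr rfl fun e _ => ?_
  rw [← Finset.sum_filter, Finset.sum_const, nsmul_eq_mul]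
  rfl

/-- In a `1`-lookahead outcome the players choose greedily. -/
theorem IsLookaheadOutcome.exists_isGreedy {G : CongestionGame N E} {A : G.Profile}
    {P : Set (Finset E)} (hP : ∀ i, G.actions i = P) (h : G.IsLookaheadOutcome 1 A) :
    ∃ σ : N → ℕ, Function.Injective σ ∧
      IsGreedy (fun e k => (G.delay e k : ℝ)) P σ fun i => (A i : Finset E) := by
  obtain ⟨σ, h⟩ := h
  refine ⟨fun i => σ i, fun i j hij => σ.injective (Fin.ext hij), fun i a ha => ?_⟩
  obtain ⟨B, ⟨S, hS, hSB⟩, hi, hBA⟩ := h i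
  let H := (G.induced (fun j => σ j < σ i) A).firstPlayers (fun j => (σ j : ℕ)) 1
  let I : {j : {j : N // ¬ σ j < σ i} // {l : {j : N // ¬ σ j < σ i} |
    (σ l : ℕ) < (σ j : ℕ)}.ncard < 1} := ⟨⟨i, lt_irrefl (σ i)⟩, hi⟩
  -- With lookahead `1` the subgame has a single player: nobody remaining precedes him, and `i` is
  -- first among those remaining.
  have huniq : ∀ j, j = I := by
    rintro ⟨⟨j, hj⟩, hj'⟩
    have h0 := (Set.ncard_eq_zero (Set.toFinite _)).1 (Nat.lt_one_iff.1 hj')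
    have : (⟨i, lt_irrefl (σ i)⟩ : {j : N // ¬ σ j < σ i}) ∉
      {l : {j : N // ¬ σ j < σ i} | (σ l : ℕ) < (σ j : ℕ)} := by rw [h0]; simp
    have hle : σ j = σ i := le_antisymm (not_lt.1 this) (not_lt.1 hj)
    have : j = i := σ.injective hle
    subst this
    rfl
  have hact : ∀ j, a ∈ H.actions j := fun j => by
    change a ∈ G.actions _
    rw [hP]
    exact ha
  have hcost : ∀ C : H.Profile, (H.cost C I : ℝ) =
      ∑ e ∈ (C I : Finset E), (G.delay e
        (load {j | (σ j : ℕ) < σ i} (fun i => (A i : Finset E)) e + 1) : ℝ) := by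
    intro C
    unfold cost
    push_cast
    refine Finset.sum_congr rfl fun e he => ?_
    have h1 : H.congestion C e = 1 := by
      unfold congestion
      rw [Set.ncard_eq_one]
      refine ⟨I, Set.eq_singleton_iff_unique_mem.2 ⟨he, fun j _ => huniq j⟩⟩
    rw [h1]
    change (G.delay e (1 + _) : ℝ) = _
    rw [add_comm]
    unfold load
    rw [← Set.ncard_coe_finset]
    congr 4
    ext j
    simp
  -- Subgame perfection is tested at the root against the strategy that plays `a`; the conditions on
  -- other players hold vacuously.
  have := hS 0 B hSB I (Nat.zero_le _) (fun j _ => ⟨a, hact j⟩)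
    (fun j hj => absurd (huniq j) hj) (fun j => ⟨a, hact j⟩)
    (fun j hj => absurd hj (Nat.not_lt_zero _)) (fun j _ => rfl)
  have : (H.cost B I : ℝ) ≤ H.cost (fun j => ⟨a, hact j⟩) I := this
  rw [hcost, hcost, hBA] at this
  exact this

end CongestionGame

/-! ### The upper bound by `rho`. -/

/-- The supremum in the definition of `rho`. -/
def rhoSup (D : Set (ℕ → ℝ≥0)) : ℝ≥0∞ :=
  ⨆ d ∈ D \ {0}, ⨆ x : ℕ, ⨆ y : ℕ,
    ENNReal.ofReal ((y : ℝ) * ((d x : ℝ) - (d y : ℝ)) / ((x : ℝ) * (d x : ℝ)))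

theorem rho_eq (D : Set (ℕ → ℝ≥0)) : rho D = (1 - rhoSup D)⁻¹ := rfl

theorem one_le_rho (D : Set (ℕ → ℝ≥0)) : 1 ≤ rho D := by
  rw [rho_eq, ENNReal.one_le_inv]
  exact tsub_le_self

/-- Clearing the denominator is harmless where `x * d x = 0`: there the left side is nonpositive, by
monotonicity if `x = 0` and by nonnegativity of `d y` if `d x = 0`. -/
theorem mul_sub_le_rhoSup {D : Set (ℕ → ℝ≥0)} {d : ℕ → ℝ≥0} (hd : d ∈ D) (hm : Monotone d)
    (hfin : rhoSup D ≠ ⊤) (x y : ℕ) :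
    (y : ℝ) * ((d x : ℝ) - d y) ≤ (rhoSup D).toReal * (x * d x) := by
  have hnn : (0 : ℝ) ≤ (rhoSup D).toReal * (x * d x) := by positivity
  rcases le_total x y with hxy | hxy
  · refine le_trans (mul_nonpos_of_nonneg_of_nonpos (Nat.cast_nonneg y) ?_) hnn
    exact sub_nonpos.2 (NNReal.coe_le_coe.2 (hm hxy))
  rcases eq_or_ne (d x) 0 with h0 | h0
  · refine le_trans (mul_nonpos_of_nonneg_of_nonpos (Nat.cast_nonneg y) ?_) hnn
    simp [h0]
  rcases Nat.eq_zero_or_pos x with rfl | hx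
  · obtain rfl : y = 0 := by omega
    simp
  have hpos : (0 : ℝ) < x * d x := by
    have : (0 : ℝ) < d x := NNReal.coe_pos.2 (pos_iff_ne_zero.2 h0)
    positivity
  rw [← div_le_iff₀ hpos]
  refine (ENNReal.ofReal_le_iff_le_toReal hfin).1 ?_
  have hd0 : d ∈ D \ {0} := ⟨hd, fun h => h0 (by rw [Set.mem_singleton_iff.1 h]; rfl)⟩
  exact le_iSup₂_of_le d hd0 (le_iSup_of_le x (le_iSup_of_le y le_rfl))

/-- For `x < y` the left side is `x d(x) + (y - x) d(x + 1)`, at most `y d(y)` by monotonicity. For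
`y ≤ x` it is `y d(x)`, which exceeds `y d(y)` by exactly the quantity bounded in `hb`. -/
theorem cost_add_marginal_le {d : ℕ → ℝ} (hd : Monotone d) {x y : ℕ} {b : ℝ}
    (hb : (y : ℝ) * (d x - d y) ≤ b * (x * d x)) (hb0 : 0 ≤ b * (x * d x)) :
    x * d x + SPTree.marginal d x y ≤ y * d y + b * (x * d x) := by
  unfold SPTree.marginal
  rcases lt_or_ge x y with h | h
  · rw [Nat.sub_eq_zero_of_le h.le, Nat.cast_sub h.le]
    have h₁ : (0 : ℝ) ≤ x * (d y - d x) :=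
      mul_nonneg (Nat.cast_nonneg x) (sub_nonneg.2 (hd h.le))
    have h₂ : (0 : ℝ) ≤ (y - x) * (d y - d (x + 1)) :=
      mul_nonneg (sub_nonneg.2 (Nat.cast_le.2 h.le)) (sub_nonneg.2 (hd h))
    push_cast
    linarith
  · rw [Nat.sub_eq_zero_of_le h, Nat.cast_sub h]
    push_cast
    linarith

namespace Network

variable {V E : Type*} [Finite E] [DecidableEq E] {Γ : Network V E} {n : ℕ} {d : E → ℕ → ℝ≥0}

theorem IsSeriesParallel.inefficiency_le_rho (h : Γ.IsSeriesParallel) {D : Set (ℕ → ℝ≥0)}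
    (hD : ∀ δ ∈ D, Monotone δ) (hd : ∀ e, d e ∈ D) {A : (Γ.game n d).Profile} {σ : Fin n → ℕ}
    (hσ : Function.Injective σ)
    (hG : IsGreedy (fun e k => (d e k : ℝ)) Γ.pathSets σ fun i => (A i : Finset E)) :
    (Γ.game n d).inefficiency A ≤ rho D := by
  have := Fintype.ofFinite E
  unfold CongestionGame.inefficiency
  split_ifs with h0
  · exact one_le_rho D
  rw [rho_eq]
  -- Truncated subtraction makes `rho D` infinite in the first case.
  rcases le_or_gt 1 (rhoSup D) with hβ | hβ
  · simp [tsub_eq_zero_of_le hβ]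
  obtain ⟨T, hT, hTE, hTP⟩ := h.exists_tree
  have hTE : T.edges = Finset.univ := Finset.coe_injective (by simpa using hTE)
  have hm : ∀ e, Monotone fun k => (d e k : ℝ) := fun e i j hij =>
    NNReal.coe_le_coe.2 (hD _ (hd e) hij)
  have hfin : rhoSup D ≠ ⊤ := (hβ.trans ENNReal.one_lt_top).ne
  have key : (1 - rhoSup D) * ((Γ.game n d).socialCost A : ℝ≥0∞) ≤ (Γ.game n d).optimalCost := by
    refine le_iInf fun B => ?_
    have hmarg := T.sum_marginal_nonneg hm hT hσ (A := fun i => (A i : Finset E))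
      (B := fun i => (B i : Finset E)) (fun i => hTP ▸ (A i).2) (hTP ▸ hG) (fun i => hTP ▸ (B i).2)
    have hsum := Finset.sum_le_sum fun e (_ : e ∈ Finset.univ) => cost_add_marginal_le (hm e)
      (mul_sub_le_rhoSup (hd e) (hD _ (hd e)) hfin
        (load Finset.univ (fun i => (A i : Finset E)) e)
        (load Finset.univ (fun i => (B i : Finset E)) e)) (by positivity)
    rw [Finset.sum_add_distrib, Finset.sum_add_distrib, ← Finset.mul_sum] at hsum
    rw [hTE] at hmarg
    have eA := (Γ.game n d).coe_socialCost A
    have eB := (Γ.game n d).coe_socialCost B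
    simp only [game] at eA eB hsum hmarg
    have hle : (1 - (rhoSup D).toReal) * ((Γ.game n d).socialCost A : ℝ) ≤
        (Γ.game n d).socialCost B := by
      simp only [game]
      rw [eA, eB]
      linarith
    have := ENNReal.ofReal_le_ofReal hle
    rw [ENNReal.ofReal_mul (sub_nonneg.2 (by
      simpa using (ENNReal.toReal_lt_toReal hfin ENNReal.one_ne_top).2 hβ |>.le)),
      ENNReal.ofReal_sub _ ENNReal.toReal_nonneg, ENNReal.ofReal_one, ENNReal.ofReal_toReal hfin,
      ENNReal.ofReal_coe_nnreal, ENNReal.ofReal_coe_nnreal] at this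
    exact this
  refine ENNReal.div_le_of_le_mul ?_
  rwa [← ENNReal.mul_le_iff_le_inv (tsub_pos_of_lt hβ).ne' (by simp)]

/-- A single deviation changes each load by at most one, and then `marginal` is exact: `d(x + 1)` on
arcs joined, `-d(x)` on arcs left, `0` elsewhere. -/
theorem IsSeriesParallel.isNash_of_isGreedy (h : Γ.IsSeriesParallel)
    (hd : ∀ e, Monotone (d e)) {A : (Γ.game n d).Profile} {σ : Fin n → ℕ}
    (hσ : Function.Injective σ)
    (hG : IsGreedy (fun e k => (d e k : ℝ)) Γ.pathSets σ fun i => (A i : Finset E)) :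
    (Γ.game n d).IsNash A := by
  have := Fintype.ofFinite E
  intro i B hB
  obtain ⟨T, hT, hTE, hTP⟩ := h.exists_tree
  have hTE : T.edges = Finset.univ := Finset.coe_injective (by simpa using hTE)
  have hm : ∀ e, Monotone fun k => (d e k : ℝ) := fun e i j hij =>
    NNReal.coe_le_coe.2 (hd e hij)
  have hmarg := T.sum_marginal_nonneg hm hT hσ (A := fun i => (A i : Finset E))
    (B := fun i => (B i : Finset E)) (fun i => hTP ▸ (A i).2) (hTP ▸ hG) (fun i => hTP ▸ (B i).2)
  rw [hTE] at hmarg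
  have hA := load_insert (Finset.notMem_erase i Finset.univ) fun i => (A i : Finset E)
  have hB' := load_insert (Finset.notMem_erase i Finset.univ) fun i => (B i : Finset E)
  have hload : ∀ e, load (Finset.univ.erase i) (fun i => (B i : Finset E)) e =
      load (Finset.univ.erase i) (fun i => (A i : Finset E)) e :=
    load_congr fun j hj => by rw [hB j (Finset.ne_of_mem_erase hj)]
  simp only [Finset.insert_erase (Finset.mem_univ i), hload] at hA hB'
  have hterm : ∀ e, SPTree.marginal (fun k => (d e k : ℝ))
      (load Finset.univ (fun i => (A i : Finset E)) e)
      (load Finset.univ (fun i => (B i : Finset E)) e) =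
      (if e ∈ (B i : Finset E) then
        (d e (load Finset.univ (fun i => (B i : Finset E)) e) : ℝ) else 0) -
      (if e ∈ (A i : Finset E) then
        (d e (load Finset.univ (fun i => (A i : Finset E)) e) : ℝ) else 0) := by
    intro e
    rw [hA e, hB' e]
    unfold SPTree.marginal
    split_ifs <;> simp
  simp only [hterm, Finset.sum_sub_distrib, Finset.sum_ite_mem, Finset.univ_inter] at hmarg
  rw [← NNReal.coe_le_coe, CongestionGame.coe_cost, CongestionGame.coe_cost]
  exact sub_nonneg.1 hmarg

theorem IsSeriesParallel.lookaheadPoA_le_rho (h : Γ.IsSeriesParallel) {D : Set (ℕ → ℝ≥0)}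
    (hD : ∀ δ ∈ D, Monotone δ) (hd : ∀ e, d e ∈ D) :
    (Γ.game n d).lookaheadPoA 1 ≤ rho D := by
  refine iSup_le fun A => ?_
  obtain ⟨σ, hσ, hG⟩ := A.2.exists_isGreedy (P := Γ.pathSets) fun _ => rfl
  exact h.inefficiency_le_rho hD hd hσ hG

theorem IsSeriesParallel.priceOfStability_le_rho (h : Γ.IsSeriesParallel) {D : Set (ℕ → ℝ≥0)}
    (hD : ∀ δ ∈ D, Monotone δ) (hd : ∀ e, d e ∈ D) :
    (Γ.game n d).priceOfStability ≤ rho D := by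
  obtain ⟨T, hT, -, hTP⟩ := h.exists_tree
  obtain ⟨A, hA, hG⟩ := T.exists_isGreedy (d := fun e k => (d e k : ℝ)) hT
    (σ := fun i : Fin n => (i : ℕ)) Fin.val_injective
  rw [hTP] at hA hG
  let A' : (Γ.game n d).Profile := fun i => ⟨A i, hA i⟩
  exact iInf_le_of_le ⟨A', h.isNash_of_isGreedy (fun e => hD _ (hd e)) Fin.val_injective hG⟩
    (h.inefficiency_le_rho hD hd Fin.val_injective hG)

end Network

theorem classPriceOfStability_le_rho {D : Set (ℕ → ℝ≥0)} (hD : ∀ d ∈ D, Monotone d) :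
    classPriceOfStability D ≤ rho D := by
  classical
  refine sSup_le ?_
  rintro q ⟨V, E, Γ, n, d, -, hE, hΓ, hd, rfl⟩
  exact hΓ.priceOfStability_le_rho hD hd

/-! ### Affine delays. -/

theorem rho_affineDelays : rho affineDelays = 4 / 3 := by
  have hs : rhoSup affineDelays = 4⁻¹ := by
    have h4 : (4⁻¹ : ℝ≥0∞) = ENNReal.ofReal (1 / 4) := by
      rw [one_div, ENNReal.ofReal_inv_of_pos (by norm_num)]
      norm_num
    refine le_antisymm ?_ ?_
    · refine iSup₂_le fun d hd => iSup_le fun x => iSup_le fun y => ?_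
      obtain ⟨⟨a, b, hab⟩, -⟩ := hd
      rw [h4]
      refine ENNReal.ofReal_le_ofReal (div_le_of_le_mul₀ (by positivity) (by norm_num) ?_)
      rw [hab, hab]
      push_cast
      -- The constant term `b` cancels in the numerator and only enlarges the denominator; the slope
      -- part is `4y(x - y) ≤ x²`, with equality at `x = 2`, `y = 1`.
      have h₁ : (0 : ℝ) ≤ a * (x - 2 * y) ^ 2 := by positivity
      have h₂ : (0 : ℝ) ≤ x * b := by positivity
      nlinarith
    · have hd : (fun x : ℕ => (x : ℝ≥0)) ∈ affineDelays \ {0} :=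
        ⟨⟨1, 0, by simp⟩, fun h => by simpa using congrFun (Set.mem_singleton_iff.1 h) 1⟩
      refine le_iSup₂_of_le _ hd (le_iSup_of_le 2 (le_iSup_of_le 1 ?_))
      rw [h4]
      refine ENNReal.ofReal_le_ofReal ?_
      norm_num
  rw [rho_eq, hs]
  have h4 : (1 - 4⁻¹ : ℝ≥0∞) = ENNReal.ofReal (3 / 4) := by
    rw [← ENNReal.ofReal_one, show (4⁻¹ : ℝ≥0∞) = ENNReal.ofReal (1 / 4) by
      rw [one_div, ENNReal.ofReal_inv_of_pos (by norm_num)]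
      norm_num, ← ENNReal.ofReal_sub _ (by norm_num)]
    norm_num
  rw [h4, ← ENNReal.ofReal_inv_of_pos (by norm_num), inv_div, ENNReal.ofReal_div_of_pos (by norm_num)]
  norm_num

/-! ### Networks of parallel chains. -/

namespace Network

section Chains

variable {m : ℕ} {len : Fin (m + 1) → ℕ}

/-- The vertex at distance `j` from the origin on the chain `i`. -/
def chainVertex (len : Fin (m + 1) → ℕ) (i : Fin (m + 1)) (j : ℕ) :
    Bool ⊕ (Σ i, Fin (len i)) :=
  if j = 0 then Sum.inl false else if h : j < len i then Sum.inr ⟨i, j, h⟩ else Sum.inl true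

/-- Parallel chains with lengths `len`. -/
def chains (len : Fin (m + 1) → ℕ) : Network (Bool ⊕ (Σ i, Fin (len i))) (Σ i, Fin (len i)) where
  src e := chainVertex len e.1 e.2
  tgt e := chainVertex len e.1 (e.2 + 1)
  origin := Sum.inl false
  dest := Sum.inl true

/-- The arcs of the chain `i`. -/
def chain (len : Fin (m + 1) → ℕ) (i : Fin (m + 1)) : Finset (Σ i, Fin (len i)) :=
  {e | e.1 = i}

theorem chainVertex_zero (i : Fin (m + 1)) : chainVertex len i 0 = Sum.inl false := by
  simp [chainVertex]

theorem chainVertex_len (hlen : ∀ i, 0 < len i) (i : Fin (m + 1)) :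
    chainVertex len i (len i) = Sum.inl true := by
  simp [chainVertex, (hlen i).ne']

/-- Chains meet only at their ends; this yields the endpoint conditions of the series and parallel
compositions. -/
theorem chainVertex_inj {i i' : Fin (m + 1)} {j j' : ℕ} (hj : j ≤ len i) (hj' : j' ≤ len i')
    (h : chainVertex len i j = chainVertex len i' j') :
    (j = 0 ∧ j' = 0) ∨ (j = len i ∧ j' = len i') ∨ (i = i' ∧ j = j') := by
  unfold chainVertex at h
  by_cases h₁ : j = 0 <;> by_cases h₂ : j' = 0 <;> by_cases h₃ : j < len i <;>
    by_cases h₄ : j' < len i' <;> simp only [h₁, h₂, h₃, h₄, if_true, if_false, dif_pos,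
      dif_neg, not_false_eq_true, reduceCtorEq, Sum.inl.injEq, Sum.inr.injEq] at h
  all_goals first
    | exact Or.inl ⟨h₁, h₂⟩
    | exact Or.inr (Or.inl ⟨by omega, by omega⟩)
    | skip
  obtain rfl : i = i' := congrArg Sigma.fst h
  exact Or.inr (Or.inr ⟨rfl, congrArg Fin.val (eq_of_heq (Sigma.mk.inj h).2)⟩)

theorem mem_endpoints_initialArcs {i : Fin (m + 1)} {j : ℕ} (hj : j < len i)
    {v : Bool ⊕ (Σ i, Fin (len i))} :
    v ∈ (chains len).endpoints {e | e.1 = i ∧ (e.2 : ℕ) < j + 1} ↔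
      ∃ k ≤ j + 1, v = chainVertex len i k := by
  constructor
  · rintro (⟨⟨i', k⟩, ⟨rfl, h⟩, rfl⟩ | ⟨⟨i', k⟩, ⟨rfl, h⟩, rfl⟩)
    · exact ⟨k, h.le, rfl⟩
    · exact ⟨k + 1, h, rfl⟩
  · rintro ⟨k, hk, rfl⟩
    rcases Nat.lt_or_ge k (j + 1) with h | h
    · exact Or.inl ⟨⟨i, k, by omega⟩, ⟨rfl, h⟩, rfl⟩
    · obtain rfl : k = j + 1 := le_antisymm hk h
      exact Or.inr ⟨⟨i, j, hj⟩, ⟨rfl, Nat.lt_succ_self j⟩, rfl⟩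

/-- Structure and walks are treated in one induction, appending an arc in series. The shift `j + 1`
keeps the arc set nonempty. -/
theorem initialArcs_seriesParallelOn (i : Fin (m + 1)) (j : ℕ) (hj : j < len i) :
    (chains len).SeriesParallelOn (Sum.inl false) (chainVertex len i (j + 1))
        {e | e.1 = i ∧ (e.2 : ℕ) < j + 1} ∧
      (chains len).walkSets (Sum.inl false) (chainVertex len i (j + 1))
        {e | e.1 = i ∧ (e.2 : ℕ) < j + 1} =
          {Finset.univ.filter fun e => e.1 = i ∧ (e.2 : ℕ) < j + 1} := by
  have harc : ∀ k (hk : k < len i), (chains len).src ⟨i, k, hk⟩ ≠ (chains len).tgt ⟨i, k, hk⟩ := by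
    intro k hk h
    have := chainVertex_inj (len := len) (i := i) (i' := i) hk.le hk h
    omega
  induction j with
  | zero =>
    have hs : {e : Σ i, Fin (len i) | e.1 = i ∧ (e.2 : ℕ) < 0 + 1} = {⟨i, 0, hj⟩} := by
      ext ⟨i', k⟩
      simp only [Set.mem_ofPred_eq, Set.mem_singleton_iff]
      constructor
      · rintro ⟨rfl, hk⟩
        congr 1
        exact Fin.ext (by simpa using hk)
      · intro h
        obtain ⟨rfl, h⟩ := Sigma.mk.inj h
        obtain rfl := eq_of_heq h
        simp
    have h₁ := SeriesParallelOn.arc (Γ := chains len) _ (harc 0 hj)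
    have h₂ := SeriesParallelOn.walkSets_arc (harc 0 hj)
    have e₁ : (chains len).src ⟨i, 0, hj⟩ = Sum.inl false := chainVertex_zero i
    rw [e₁] at h₁ h₂
    rw [hs]
    refine ⟨h₁, h₂.trans ?_⟩
    congr 1
    ext e
    have := Set.ext_iff.1 hs e
    simpa using this.symm
  | succ j ih =>
    obtain ⟨i₁, i₂⟩ := ih (by omega)
    have hs : {e : Σ i, Fin (len i) | e.1 = i ∧ (e.2 : ℕ) < j + 1 + 1} =
        {e | e.1 = i ∧ (e.2 : ℕ) < j + 1} ∪ {⟨i, j + 1, hj⟩} := by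
      ext ⟨i', k⟩
      simp only [Set.mem_ofPred_eq, Set.mem_singleton_iff, Set.mem_union]
      constructor
      · rintro ⟨rfl, hk⟩
        rcases Nat.lt_or_ge k (j + 1) with h | h
        · exact Or.inl ⟨rfl, h⟩
        · right
          congr 1
          exact Fin.ext (by simp; omega)
      · rintro (⟨rfl, h⟩ | h)
        · exact ⟨rfl, by omega⟩
        · obtain ⟨rfl, h⟩ := Sigma.mk.inj h
          obtain rfl := eq_of_heq h
          simp
    have hV : (chains len).endpoints {e | e.1 = i ∧ (e.2 : ℕ) < j + 1} ∩
        (chains len).endpoints {⟨i, j + 1, hj⟩} = {chainVertex len i (j + 1)} := by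
      ext v
      rw [Set.mem_inter_iff, mem_endpoints_initialArcs (by omega), Set.mem_singleton_iff]
      constructor
      · rintro ⟨⟨k, hk, rfl⟩, ⟨e, he, h⟩ | ⟨e, he, h⟩⟩
        · rw [Set.mem_singleton_iff.1 he] at h
          exact h.symm
        · rw [Set.mem_singleton_iff.1 he] at h
          have := chainVertex_inj (len := len) (i := i) (i' := i) hj (by omega) h
          omega
      · rintro rfl
        exact ⟨⟨j + 1, le_rfl, rfl⟩, Or.inl ⟨_, rfl, rfl⟩⟩
    have h₂ := SeriesParallelOn.arc (Γ := chains len) _ (harc (j + 1) hj)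
    rw [hs]
    refine ⟨.series _ _ _ _ _ i₁ h₂ ?_ hV, ?_⟩
    · rw [Set.disjoint_singleton_right]
      simp
    · refine (SeriesParallelOn.walkSets_series i₁ h₂ hV).trans ?_
      have hw := SeriesParallelOn.walkSets_arc (harc (j + 1) hj)
      rw [show (chains len).src ⟨i, j + 1, hj⟩ = chainVertex len i (j + 1) from rfl] at hw
      rw [i₂, hw]
      ext a
      simp only [Set.mem_singleton_iff, Set.mem_ofPred_eq, exists_eq_left]
      refine iff_of_eq (congrArg _ ?_)
      ext e
      have := Set.ext_iff.1 hs e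
      simpa using this.symm

theorem chain_seriesParallelOn (hlen : ∀ i, 0 < len i) (i : Fin (m + 1)) :
    (chains len).SeriesParallelOn (Sum.inl false) (Sum.inl true) {e | e.1 = i} ∧
      (chains len).walkSets (Sum.inl false) (Sum.inl true) {e | e.1 = i} = {chain len i} ∧
      ∀ v, v ∈ (chains len).endpoints {e | e.1 = i} ↔ ∃ k ≤ len i, v = chainVertex len i k := by
  have h := initialArcs_seriesParallelOn (len := len) i (len i - 1) (Nat.sub_lt (hlen i) one_pos)
  have hv := @mem_endpoints_initialArcs m len i (len i - 1) (Nat.sub_lt (hlen i) one_pos)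
  have h1 : len i - 1 + 1 = len i := Nat.succ_pred_eq_of_pos (hlen i)
  have hs : {e : Σ i, Fin (len i) | e.1 = i ∧ (e.2 : ℕ) < len i} = {e | e.1 = i} := by
    ext ⟨i', k⟩
    simp only [Set.mem_ofPred_eq, and_iff_left_iff_imp]
    rintro rfl
    exact k.2
  have hs' : (Finset.univ.filter fun e : Σ i, Fin (len i) => e.1 = i ∧ (e.2 : ℕ) < len i) =
      chain len i := by
    ext e
    simpa [chain] using Set.ext_iff.1 hs e
  rw [h1, chainVertex_len hlen, hs, hs'] at h
  rw [h1, hs] at hv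
  exact ⟨h.1, h.2, fun v => hv⟩

/-- Chains are added in parallel one by one; the endpoint clause is carried along to compute the
intersection with the next chain. -/
theorem initialChains_seriesParallelOn (hlen : ∀ i, 0 < len i) (k : ℕ) (hk : k < m + 1) :
    (chains len).SeriesParallelOn (Sum.inl false) (Sum.inl true) {e | (e.1 : ℕ) < k + 1} ∧
      (chains len).walkSets (Sum.inl false) (Sum.inl true) {e | (e.1 : ℕ) < k + 1} =
        {a | ∃ i : Fin (m + 1), (i : ℕ) < k + 1 ∧ a = chain len i} ∧
      ∀ v, v ∈ (chains len).endpoints {e | (e.1 : ℕ) < k + 1} →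
        ∃ i : Fin (m + 1), (i : ℕ) < k + 1 ∧ ∃ j ≤ len i, v = chainVertex len i j := by
  induction k with
  | zero =>
    obtain ⟨h₁, h₂, h₃⟩ := chain_seriesParallelOn hlen (0 : Fin (m + 1))
    have hs : {e : Σ i, Fin (len i) | (e.1 : ℕ) < 0 + 1} = {e | e.1 = 0} := by
      ext e
      rw [Set.mem_ofPred_eq, Set.mem_ofPred_eq, Fin.ext_iff, Nat.lt_one_iff, Fin.val_zero]
    rw [hs]
    refine ⟨h₁, h₂.trans ?_, fun v hv => ⟨0, by simp, (h₃ v).1 hv⟩⟩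
    ext a
    simp only [Set.mem_singleton_iff, Set.mem_ofPred_eq]
    constructor
    · rintro rfl
      exact ⟨0, by simp, rfl⟩
    · rintro ⟨i, hi, rfl⟩
      congr 1
      exact Fin.ext (by simpa using hi)
  | succ k ih =>
    obtain ⟨g₁, g₂, g₃⟩ := ih (by omega)
    obtain ⟨h₁, h₂, h₃⟩ := chain_seriesParallelOn hlen (⟨k + 1, hk⟩ : Fin (m + 1))
    have hs : {e : Σ i, Fin (len i) | (e.1 : ℕ) < k + 1 + 1} =
        {e | (e.1 : ℕ) < k + 1} ∪ {e | e.1 = ⟨k + 1, hk⟩} := by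
      ext e
      simp only [Set.mem_ofPred_eq, Set.mem_union, Fin.ext_iff]
      omega
    have hV : (chains len).endpoints {e | (e.1 : ℕ) < k + 1} ∩
        (chains len).endpoints {e | e.1 = ⟨k + 1, hk⟩} = {Sum.inl false, Sum.inl true} := by
      ext v
      constructor
      · rintro ⟨hv, hv'⟩
        obtain ⟨i, hi, j, hj, rfl⟩ := g₃ v hv
        obtain ⟨l, hl, hv'⟩ := (h₃ _).1 hv'
        rcases chainVertex_inj hj hl hv' with ⟨rfl, -⟩ | ⟨rfl, -⟩ | ⟨rfl, -⟩
        · exact Or.inl (chainVertex_zero i)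
        · exact Or.inr (chainVertex_len hlen i)
        · exact absurd hi (lt_irrefl _)
      · rintro (rfl | rfl)
        · exact ⟨g₁.terminals.1, h₁.terminals.1⟩
        · exact ⟨g₁.terminals.2.1, h₁.terminals.2.1⟩
    rw [hs]
    refine ⟨.parallel _ _ _ _ g₁ h₁ ?_ hV, ?_, ?_⟩
    · rw [Set.disjoint_left]
      intro e he he'
      rw [Set.mem_ofPred_eq] at he he'
      simp [he'] at he
    · rw [SeriesParallelOn.walkSets_parallel g₁ h₁ hV, g₂, h₂]
      ext a
      simp only [Set.mem_union, Set.mem_singleton_iff, Set.mem_ofPred_eq]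
      constructor
      · rintro (⟨i, hi, rfl⟩ | rfl)
        · exact ⟨i, by omega, rfl⟩
        · exact ⟨_, Nat.lt_succ_self _, rfl⟩
      · rintro ⟨i, hi, rfl⟩
        rcases Nat.lt_or_ge i (k + 1) with h | h
        · exact Or.inl ⟨i, h, rfl⟩
        · right
          congr 1
          exact Fin.ext (by simp; omega)
    · intro v hv
      have : v ∈ (chains len).endpoints {e | (e.1 : ℕ) < k + 1} ∨
          v ∈ (chains len).endpoints {e | e.1 = ⟨k + 1, hk⟩} := by
        simp only [endpoints, Set.image_union] at hv ⊢
        rcases hv with (hv | hv) | (hv | hv)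
        exacts [.inl (.inl hv), .inr (.inl hv), .inl (.inr hv), .inr (.inr hv)]
      rcases this with hv | hv
      · obtain ⟨i, hi, h⟩ := g₃ v hv
        exact ⟨i, by omega, h⟩
      · exact ⟨_, Nat.lt_succ_self _, (h₃ v).1 hv⟩

theorem chains_isSeriesParallel (hlen : ∀ i, 0 < len i) : (chains len).IsSeriesParallel := by
  have h := (initialChains_seriesParallelOn hlen m (Nat.lt_succ_self m)).1
  have hs : {e : Σ i, Fin (len i) | (e.1 : ℕ) < m + 1} = Set.univ :=
    Set.eq_univ_of_forall fun e => e.1.2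
  rwa [hs] at h

theorem chains_pathSets (hlen : ∀ i, 0 < len i) : (chains len).pathSets = Set.range (chain len) := by
  have h := (initialChains_seriesParallelOn hlen m (Nat.lt_succ_self m)).2.1
  have hs : {e : Σ i, Fin (len i) | (e.1 : ℕ) < m + 1} = Set.univ :=
    Set.eq_univ_of_forall fun e => e.1.2
  rw [hs] at h
  rw [(chains_isSeriesParallel hlen).pathSets_eq]
  refine h.trans ?_
  ext a
  constructor
  · rintro ⟨i, -, rfl⟩
    exact ⟨i, rfl⟩
  · rintro ⟨i, rfl⟩
    exact ⟨i, i.2, rfl⟩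

end Chains

end Network

/-! ### The discrete Pigou game. -/

namespace Network

section PigouGame

variable {n : ℕ} {l k : ℕ} {δ δ₀ : ℕ → ℝ≥0}

/-- The length of the chains in a discrete version of the Pigou network: one chain of length `l`, and
`n` chains of length `k`. -/
def pigouLen (n l k : ℕ) (i : Fin (n + 1)) : ℕ := if i = 0 then l else k

/-- The game with `n` players on the chains of lengths `pigouLen n l k`, with the delay function `δ`
on the first chain and `δ₀` on the others. -/
def pigouGame (n l k : ℕ) (δ δ₀ : ℕ → ℝ≥0) :
    CongestionGame (Fin n) (Σ i, Fin (pigouLen n l k i)) :=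
  (chains (pigouLen n l k)).game n fun e => if e.1 = 0 then δ else δ₀

theorem pigouLen_pos (hl : 0 < l) (hk : 0 < k) (i : Fin (n + 1)) : 0 < pigouLen n l k i := by
  unfold pigouLen
  split_ifs <;> assumption

theorem mem_chain {m : ℕ} {len : Fin (m + 1) → ℕ} {i : Fin (m + 1)} {e : Σ i, Fin (len i)} :
    e ∈ chain len i ↔ e.1 = i := by
  simp [chain]

theorem card_chain {m : ℕ} (len : Fin (m + 1) → ℕ) (i : Fin (m + 1)) :
    (chain len i).card = len i := by
  have : chain len i = Finset.univ.map (Function.Embedding.sigmaMk i) := by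
    ext ⟨i', j⟩
    simp only [mem_chain, Finset.mem_map, Finset.mem_univ, true_and, Function.Embedding.sigmaMk_apply]
    constructor
    · rintro rfl
      exact ⟨j, rfl⟩
    · rintro ⟨j', h⟩
      exact (congrArg Sigma.fst h).symm
  rw [this, Finset.card_map, Finset.card_univ, Fintype.card_fin]

theorem pigouGame_cost (A : (pigouGame n l k δ δ₀).Profile) {p : Fin n} {i : Fin (n + 1)}
    {c : ℝ≥0} (hA : (A p).1 = chain (pigouLen n l k) i) :
    ((∀ e, e.1 = i →
        (if i = 0 then δ else δ₀) ((pigouGame n l k δ δ₀).congestion A e) ≤ c) →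
      (pigouGame n l k δ δ₀).cost A p ≤ pigouLen n l k i * c) ∧
    ((∀ e, e.1 = i →
        c ≤ (if i = 0 then δ else δ₀) ((pigouGame n l k δ δ₀).congestion A e)) →
      pigouLen n l k i * c ≤ (pigouGame n l k δ δ₀).cost A p) := by
  have hdel : ∀ e ∈ chain (pigouLen n l k) i,
      (pigouGame n l k δ δ₀).delay e = if i = 0 then δ else δ₀ := fun e he => by
    rw [← mem_chain.1 he]
    rfl
  unfold CongestionGame.cost
  rw [hA, ← nsmul_eq_mul, ← card_chain (pigouLen n l k) i]
  constructor
  · refine fun h => Finset.sum_le_card_nsmul _ _ _ fun e he => ?_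
    rw [hdel e he]
    exact h e (mem_chain.1 he)
  · refine fun h => Finset.card_nsmul_le_sum _ _ _ fun e he => ?_
    rw [hdel e he]
    exact h e (mem_chain.1 he)

theorem pigouGame_cost_zero (A : (pigouGame n l k δ δ₀).Profile) {p : Fin n} {c : ℝ≥0}
    (hA : (A p).1 = chain (pigouLen n l k) 0) :
    ((∀ e, e.1 = 0 → δ ((pigouGame n l k δ δ₀).congestion A e) ≤ c) →
      (pigouGame n l k δ δ₀).cost A p ≤ l * c) ∧
    ((∀ e, e.1 = 0 → c ≤ δ ((pigouGame n l k δ δ₀).congestion A e)) →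
      l * c ≤ (pigouGame n l k δ δ₀).cost A p) :=
  pigouGame_cost A hA

theorem pigouGame_cost_of_ne_zero (A : (pigouGame n l k δ δ₀).Profile) {p : Fin n}
    {i : Fin (n + 1)} (hi : i ≠ 0) {c : ℝ≥0} (hA : (A p).1 = chain (pigouLen n l k) i) :
    ((∀ e, e.1 = i → δ₀ ((pigouGame n l k δ δ₀).congestion A e) ≤ c) →
      (pigouGame n l k δ δ₀).cost A p ≤ k * c) ∧
    ((∀ e, e.1 = i → c ≤ δ₀ ((pigouGame n l k δ δ₀).congestion A e)) →
      k * c ≤ (pigouGame n l k δ δ₀).cost A p) := by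
  have h := pigouGame_cost (c := c) A hA
  have hlen : pigouLen n l k i = k := if_neg hi
  simp only [if_neg hi] at h
  rwa [show (pigouLen n l k i : ℝ≥0) = k by rw [hlen]] at h

theorem congestion_le (A : (pigouGame n l k δ δ₀).Profile) (e : Σ i, Fin (pigouLen n l k i)) :
    (pigouGame n l k δ δ₀).congestion A e ≤ n := by
  have := Set.ncard_le_card {i : Fin n | e ∈ (A i : Finset _)}
  simpa [CongestionGame.congestion] using this

/-- All players use the first chain in a Nash equilibrium. -/
theorem pigouGame_isNash_eq (hl : 0 < l) (hk : 0 < k) (hδ : Monotone δ) (hδ₀ : Monotone δ₀)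
    (hlt : l * δ n < k * δ₀ 1) {A : (pigouGame n l k δ δ₀).Profile}
    (hA : (pigouGame n l k δ δ₀).IsNash A) (p : Fin n) : (A p).1 = chain (pigouLen n l k) 0 := by
  have hacts := chains_pathSets (pigouLen_pos (n := n) hl hk)
  have hmem : (A p : Finset _) ∈ (chains (pigouLen n l k)).pathSets := (A p).2
  rw [hacts] at hmem
  obtain ⟨i, hi⟩ := hmem
  by_cases hi0 : i = 0
  · rw [← hi, hi0]
  exfalso
  have h0 : chain _ 0 ∈ (chains (pigouLen n l k)).pathSets := by
    rw [hacts]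
    exact ⟨0, rfl⟩
  -- Whatever the others do, the first chain costs at most `l * δ n` and any other chain at least `k
  -- * δ₀ 1`, so this deviation pays.
  let B : (pigouGame n l k δ δ₀).Profile := Function.update A p ⟨chain _ 0, h0⟩
  have h₁ := hA p B fun j hj => Function.update_of_ne hj _ _
  have h₂ := (pigouGame_cost_zero B (p := p) (c := δ n) (by simp [B])).1 fun e _ =>
    hδ (congestion_le B e)
  have h₃ := (pigouGame_cost_of_ne_zero A hi0 (c := δ₀ 1) hi.symm).2 fun e he => by
    refine hδ₀ (Nat.one_le_iff_ne_zero.2 ?_)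
    unfold CongestionGame.congestion
    refine Set.ncard_ne_zero_of_mem (a := p) ?_ (Set.toFinite _)
    rw [Set.mem_ofPred_eq, ← hi, mem_chain]
    exact he
  exact absurd hlt (not_lt.2 (h₃.trans (h₁.trans h₂)))

theorem pigouGame_socialCost_of_isNash (hl : 0 < l) (hk : 0 < k) (hδ : Monotone δ)
    (hδ₀ : Monotone δ₀) (hlt : l * δ n < k * δ₀ 1) {A : (pigouGame n l k δ δ₀).Profile}
    (hA : (pigouGame n l k δ δ₀).IsNash A) :
    (pigouGame n l k δ δ₀).socialCost A = n * (l * δ n) := by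
  have h0 := pigouGame_isNash_eq hl hk hδ hδ₀ hlt hA
  have hc : ∀ e, e.1 = 0 → (pigouGame n l k δ δ₀).congestion A e = n := fun e he => by
    unfold CongestionGame.congestion
    have : {i : Fin n | e ∈ (A i : Finset _)} = Set.univ :=
      Set.eq_univ_of_forall fun i => by
        rw [Set.mem_ofPred_eq, h0 i, mem_chain]
        exact he
    rw [this, Set.ncard_univ, Nat.card_fin]
  have hp : ∀ p, (pigouGame n l k δ δ₀).cost A p = l * δ n := fun p =>
    le_antisymm ((pigouGame_cost_zero A (h0 p)).1 fun e he => by rw [hc e he])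
      ((pigouGame_cost_zero A (h0 p)).2 fun e he => by rw [hc e he])
  simp [CongestionGame.socialCost, hp]

theorem exists_pigouGame_socialCost_le (hl : 0 < l) (hk : 0 < k) (hδ : Monotone δ)
    (hδ₀ : Monotone δ₀) {y : ℕ} (hy : y ≤ n) : ∃ B : (pigouGame n l k δ δ₀).Profile,
      (pigouGame n l k δ δ₀).socialCost B ≤ y * (l * δ y) + (n - y : ℕ) * (k * δ₀ 1) := by
  have hacts := chains_pathSets (pigouLen_pos (n := n) hl hk)
  have hmem : ∀ i, chain _ i ∈ (chains (pigouLen n l k)).pathSets := fun i => by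
    rw [hacts]
    exact ⟨i, rfl⟩
  -- The first `y` players share the first chain; each of the others has a chain to himself.
  let f : Fin n → Fin (n + 1) := fun p => if (p : ℕ) < y then 0 else p.succ
  let B : (pigouGame n l k δ δ₀).Profile := fun p => ⟨chain _ (f p), hmem (f p)⟩
  have hcong : ∀ e, (pigouGame n l k δ δ₀).congestion B e = {p | f p = e.1}.ncard := fun e => by
    unfold CongestionGame.congestion
    congr 1
    ext p
    simp only [B, Set.mem_ofPred_eq, mem_chain]
    exact eq_comm
  have hcount : {p : Fin n | (p : ℕ) < y}.ncard = y := by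
    rw [← Set.ncard_image_of_injective _ Fin.val_injective]
    have : (fun p : Fin n => (p : ℕ)) '' {p : Fin n | (p : ℕ) < y} = Set.Iio y := by
      ext q
      constructor
      · rintro ⟨p, hp, rfl⟩
        exact hp
      · intro hq
        exact ⟨⟨q, lt_of_lt_of_le hq hy⟩, hq, rfl⟩
    rw [this, Set.ncard_eq_toFinset_card']
    simp
  have hB : ∀ p : Fin n, (pigouGame n l k δ δ₀).cost B p ≤
      if (p : ℕ) < y then l * δ y else k * δ₀ 1 := by
    intro p
    split_ifs with hp
    · refine (pigouGame_cost_zero B (p := p) ?_).1 fun e he => hδ ?_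
      · simp [B, f, hp]
      · rw [hcong, he, ← hcount]
        refine Set.ncard_le_ncard (fun q hq => ?_) (Set.toFinite _)
        by_contra h
        have h' : ¬ (q : ℕ) < y := fun h' => h h'
        simp [f, h'] at hq
    · refine (pigouGame_cost_of_ne_zero B (p := p) (i := p.succ) (Fin.succ_ne_zero p) ?_).1
        fun e he => hδ₀ ?_
      · simp [B, f, hp]
      · rw [hcong, he]
        refine (Set.ncard_le_ncard (t := {p}) (fun q hq => ?_) (Set.toFinite _)).trans
          (Set.ncard_singleton p).le
        rw [Set.mem_ofPred_eq] at hq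
        simp only [f] at hq
        split_ifs at hq with h
        · exact absurd hq.symm (Fin.succ_ne_zero p)
        · exact Fin.succ_injective _ hq
  refine ⟨B, (Finset.sum_le_sum fun p _ => hB p).trans (le_of_eq ?_)⟩
  have h₁ : (Finset.univ.filter fun p : Fin n => (p : ℕ) < y).card = y := by
    rw [← Set.ncard_coe_finset]
    simpa using hcount
  have h₂ : (Finset.univ.filter fun p : Fin n => ¬ (p : ℕ) < y).card = n - y := by
    have := Finset.card_filter_add_card_filter_not (s := Finset.univ) (fun p : Fin n => (p : ℕ) < y)
    rw [h₁, Finset.card_univ, Fintype.card_fin] at this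
    omega
  rw [Finset.sum_ite, Finset.sum_const, Finset.sum_const, h₁, h₂, nsmul_eq_mul, nsmul_eq_mul]

theorem pigouGame_le_priceOfStability (hl : 0 < l) (hk : 0 < k) (hδ : Monotone δ)
    (hδ₀ : Monotone δ₀) (hn : 0 < n) (hδn : 0 < δ n) (hlt : l * δ n < k * δ₀ 1) {y : ℕ}
    (hy : y ≤ n) :
    ((n * (l * δ n) : ℝ≥0) : ℝ≥0∞) / ((y * (l * δ y) + (n - y : ℕ) * (k * δ₀ 1) : ℝ≥0) : ℝ≥0∞) ≤
      (pigouGame n l k δ δ₀).priceOfStability := by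
  refine le_iInf fun A => ?_
  have hA := pigouGame_socialCost_of_isNash hl hk hδ hδ₀ hlt A.2
  unfold CongestionGame.inefficiency
  rw [hA, if_neg (by positivity)]
  obtain ⟨B, hB⟩ := exists_pigouGame_socialCost_le hl hk hδ hδ₀ hy
  exact ENNReal.div_le_div_left (iInf_le_of_le B (ENNReal.coe_le_coe.2 hB)) _

theorem pigouGame_priceOfStability_le {D : Set (ℕ → ℝ≥0)} (hl : 0 < l) (hk : 0 < k) (hδ : δ ∈ D)
    (hδ₀ : δ₀ ∈ D) : (pigouGame n l k δ δ₀).priceOfStability ≤ classPriceOfStability D := by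
  refine le_sSup ⟨_, _, chains (pigouLen n l k), n, fun e => if e.1 = 0 then δ else δ₀,
    inferInstance, inferInstance, chains_isSeriesParallel (pigouLen_pos hl hk), fun e => ?_, rfl⟩
  dsimp only
  split_ifs <;> assumption

end PigouGame

end Network

/-! ### The lower bound on the Price of Stability. -/

section LowerBound

open Network

theorem one_le_classPriceOfStability {D : Set (ℕ → ℝ≥0)} {δ : ℕ → ℝ≥0} (hδ : δ ∈ D) :
    1 ≤ classPriceOfStability D := by
  -- Without players every outcome costs `0` and has ratio `1`.
  refine le_trans ?_ (pigouGame_priceOfStability_le (n := 0) one_pos one_pos hδ hδ)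
  refine le_iInf fun A => ?_
  simp [CongestionGame.inefficiency, CongestionGame.socialCost]

/-- Working with the inverse covers an infinite Price of Stability, for which `c = 0`. -/
theorem inv_classPriceOfStability_le {D : Set (ℕ → ℝ≥0)} (hD : ∀ d ∈ D, Monotone d)
    {δ δ₀ : ℕ → ℝ≥0} (hδ : δ ∈ D) (hδ₀ : δ₀ ∈ D) (h₀ : 0 < δ₀ 1) {x y : ℕ} (hy : y < x)
    (hx : 0 < δ x) :
    (classPriceOfStability D)⁻¹.toReal * (x * δ x) ≤ y * δ y + (x - y) * δ x := by
  set c := (classPriceOfStability D)⁻¹.toReal with hc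
  have hx0 : 0 < x := by omega
  have h₀' : (0 : ℝ) < δ₀ 1 := h₀
  have hyx : (y : ℝ) ≤ x := Nat.cast_le.2 hy.le
  have key : ∀ l : ℕ, 0 < l → c * (x * (l * δ x)) ≤ y * (l * δ y) + (x - y) * (l * δ x + δ₀ 1) := by
    intro l hl
    -- The length `k = f + 1` is the least with `l δ(x) < k δ₀(1)`, so `k δ₀(1)` overshoots by at
    -- most `δ₀(1)`, independently of `l`.
    have hk₁ := Nat.lt_floor_add_one ((l * δ x : ℝ) / δ₀ 1)
    have hk₂ := Nat.floor_le (show (0 : ℝ) ≤ (l * δ x : ℝ) / δ₀ 1 by positivity)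
    rw [div_lt_iff₀ h₀'] at hk₁
    rw [le_div_iff₀ h₀'] at hk₂
    set f := ⌊(l * δ x : ℝ) / δ₀ 1⌋₊
    have hlt : l * δ x < ((f + 1 : ℕ) : ℝ≥0) * δ₀ 1 := by
      rw [← NNReal.coe_lt_coe]
      push_cast
      exact hk₁
    have h := (pigouGame_le_priceOfStability hl (Nat.succ_pos f) (hD _ hδ) (hD _ hδ₀) hx0 hx hlt
      hy.le).trans (pigouGame_priceOfStability_le hl (Nat.succ_pos f) hδ hδ₀)
    set S : ℝ≥0 := x * (l * δ x) with hS
    set W : ℝ≥0 := y * (l * δ y) + (x - y : ℕ) * ((f + 1 : ℕ) * δ₀ 1) with hW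
    have hS0 : 0 < S := by positivity
    have hW0 : 0 < W := by
      have : (0 : ℝ≥0) < (x - y : ℕ) := Nat.cast_pos.2 (by omega)
      positivity
    have h' := ENNReal.inv_le_inv.2 h
    rw [ENNReal.inv_div (Or.inl ENNReal.coe_ne_top) (Or.inl (by exact_mod_cast hW0.ne')),
      ← ENNReal.coe_div hS0.ne'] at h'
    have h'' := ENNReal.toReal_mono ENNReal.coe_ne_top h'
    rw [← hc, ENNReal.coe_toReal, NNReal.coe_div, le_div_iff₀ (NNReal.coe_pos.2 hS0), hS, hW] at h''
    simp only [NNReal.coe_add, NNReal.coe_mul, NNReal.coe_natCast, Nat.cast_sub hy.le,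
      Nat.cast_add, Nat.cast_one] at h''
    refine h''.trans (add_le_add le_rfl (mul_le_mul_of_nonneg_left ?_ (sub_nonneg.2 hyx)))
    push_cast
    linarith
  -- The error `(x - y) δ₀(1)` in `key` is bounded while all other terms scale with `l`, so a large
  -- `l` refutes any strict violation.
  by_contra! hlt
  obtain ⟨l, hl⟩ := exists_nat_gt
    (((x : ℝ) - y) * δ₀ 1 / (c * (x * δ x) - (y * δ y + (x - y) * δ x)))
  rw [div_lt_iff₀ (sub_pos.2 hlt)] at hl
  have hl0 : 0 < l := by
    rcases Nat.eq_zero_or_pos l with rfl | h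
    · have : (0 : ℝ) ≤ (x - y) * δ₀ 1 := mul_nonneg (sub_nonneg.2 hyx) h₀'.le
      simp only [Nat.cast_zero, zero_mul] at hl
      linarith
    · exact h
  have := key l hl0
  linarith

theorem rho_le_classPriceOfStability {D : Set (ℕ → ℝ≥0)} (hD : ∀ d ∈ D, Monotone d)
    {δ₀ : ℕ → ℝ≥0} (hδ₀ : δ₀ ∈ D) (h₀ : 0 < δ₀ 1) : rho D ≤ classPriceOfStability D := by
  have hone := one_le_classPriceOfStability hδ₀
  have hinv : (classPriceOfStability D)⁻¹ ≤ 1 := ENNReal.inv_le_one.2 hone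
  have hfin : (classPriceOfStability D)⁻¹ ≠ ⊤ := (hinv.trans_lt ENNReal.one_lt_top).ne
  have hsup : rhoSup D ≤ 1 - (classPriceOfStability D)⁻¹ := by
    refine iSup₂_le fun δ hδ => iSup_le fun x => iSup_le fun y => ?_
    rcases le_or_gt x y with hxy | hxy
    · rw [ENNReal.ofReal_of_nonpos]
      · exact zero_le
      · exact div_nonpos_of_nonpos_of_nonneg (mul_nonpos_of_nonneg_of_nonpos (Nat.cast_nonneg y)
          (sub_nonpos.2 (NNReal.coe_le_coe.2 (hD _ hδ.1 hxy)))) (by positivity)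
    rcases eq_or_ne (δ x) 0 with hx | hx
    · simp [hx]
    have hx := pos_iff_ne_zero.2 hx
    have h := inv_classPriceOfStability_le hD hδ.1 hδ₀ h₀ hxy hx
    have hpos : (0 : ℝ) < x * δ x := mul_pos (Nat.cast_pos.2 (by omega)) (NNReal.coe_pos.2 hx)
    rw [← ENNReal.ofReal_toReal hfin, ← ENNReal.ofReal_one,
      ← ENNReal.ofReal_sub _ ENNReal.toReal_nonneg]
    refine ENNReal.ofReal_le_ofReal ?_
    rw [div_le_iff₀ hpos]
    linarith
  rw [rho_eq, ENNReal.inv_le_iff_inv_le]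
  calc (classPriceOfStability D)⁻¹ = 1 - (1 - (classPriceOfStability D)⁻¹) :=
        (ENNReal.sub_sub_cancel ENNReal.one_ne_top hinv).symm
    _ ≤ 1 - rhoSup D := tsub_le_tsub_left hsup 1

end LowerBound

end

theorem mainTheorem6 (D : Set (ℕ → ℝ≥0)) (hD : ∀ d ∈ D, Monotone d) :
    (∀ (V : Type*) (E : Type*) [Finite V] [Finite E] (Γ : Network V E), Γ.IsSeriesParallel →
      ∀ (n : ℕ) (d : E → ℕ → ℝ≥0), (∀ e, d e ∈ D) →
        (Γ.game n d).lookaheadPoA 1 ≤ rho D) ∧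
    ((∃ d ∈ D, 0 < d 1) → rho D = classPriceOfStability D) ∧
    rho affineDelays = 4 / 3 := by
  classical
  refine ⟨fun V E _ _ Γ hΓ n d hd => hΓ.lookaheadPoA_le_rho hD hd, ?_, rho_affineDelays⟩
  rintro ⟨δ₀, hδ₀, h₀⟩
  exact le_antisymm (rho_le_classPriceOfStability hD hδ₀ h₀) (classPriceOfStability_le_rho hD)
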